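/- All graphs are finite and simple, and $\log$ is the natural logarithm. For a graph $F$ and $\lambda>0$ let $Z_F(\lambda)=\sum_I\lambda^{|I|}$, where $I$ ranges over the independent sets of $F$ (including $\varnothing$); the null graph has $Z=1$. Given a graph $G$, $\lambda>0$ and positive reals $(\beta_u,\gamma_u)_{u\in V(G)}$, the hard-core model on $G$ at fugacity $\lambda$ has *local $(\beta_u,\gamma_u)_u$-occupancy* if $$\beta_u\frac{\lambda}{1+\lambda}\frac1{Z_F(\lambda)}+\gamma_u\frac{\lambda Z_F'(\lambda)}{Z_F(\lambda)}\ge 1$$ for each $u\in V(G)$ and each induced subgraph $F$ of $G[N(u)]$ (the null graph included), and *strong local $(\beta_u,\gamma_u)_u$-occupancy* if this holds for each $u$ and every (not necessarily induced) subgraph $F$ of $G[N(u)]$. A *cover* of $G$ is a pair $\mathscr H=(L,H)$ of a graph $H$ and a map $L$ from $V(G)$ to subsets of $V(H)$ such that the sets $L(u)$ partition $V(H)$; each $H[L(u)]$ is complete; there are edges of $H$ between $L(u)$ and $L(v)$, $u\ne v$, only if $uv\in E(G)$; and if $uv\in E(G)$, the edges of $H$ between $L(u)$ and $L(v)$ form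 a (possibly empty) matching. An *$\mathscr H$-colouring* of $G$ is an independent set of $H$ of size $|V(G)|$. The cover *arises from a list-assignment* $A$ (a finite set $A(u)$ of positive integers for each vertex $u$) if, up to isomorphism, $V(H)=\{(u,c): c\in A(u)\}$, $L(u)=\{u\}\times A(u)$, and distinct $(u,c),(v,c')$ are adjacent if and only if $u=v$, or $uv\in E(G)$ and $c=c'$. **Theorem.** Let $G$ be a graph of maximum degree $\Delta$, let $\mathscr H=(L,H)$ be a cover of $G$, let $\lambda>0$ and let $(\beta_u,\gamma_u)_u$ be a collection of pairs of positive reals. Suppose that (A) or (B) holds. (A) $\Delta\ge 2^6$, and for some $\ell>7\log\Delta$ and all $u\in V(G)$ $$|L(u)|\ge \beta_u\frac{\lambda}{1+\lambda}\,\frac{\ell}{1-\sqrt{(7\log\Delta)/\ell}}+\gamma_u\deg(u),$$ and $Z_F(\lambda)\ge 8\Delta^4$ for all induced subgraphs $F$ of $G[N(u)]$ on at least $\ell/8$ vertices. (B) For some collection $(\ell_u,\eta_u)_u$ of pairs of positive reals with $\eta_u<1$, and all $u\in V(G)$, $$\frac{1+\lambda}{\beta_u\lambda}\bigl(|L(u)|-\gamma_u\deg(u)\bigr)\ge\max\left\{\frac{\ell_u}{1-\eta_u},\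 \frac{6\log(2\Delta)}{\eta_u^2}\right\}$$ (if $\Delta=0$ the second entry of the maximum is omitted), and $Z_F(\lambda)\ge 8|L(u)|\Delta^3$ for all induced subgraphs $F$ of $G[N(u)]$ on more than $\ell^*_u=\min_{v\in N(u)}\ell_v/8$ vertices (no condition if $N(u)=\varnothing$). If $\mathscr H$ arises from a list-assignment of $G$ and the hard-core model on $G$ at fugacity $\lambda$ has local $(\beta_u,\gamma_u)_u$-occupancy, then $G$ admits an $\mathscr H$-colouring. For an arbitrary cover $\mathscr H$, if the hard-core model on $G$ at fugacity $\lambda$ has strong local $(\beta_u,\gamma_u)_u$-occupancy, then $G$ admits an $\mathscr H$-colouring. -/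

import Mathlib

open Polynomial

namespace LocalOccupancy

universe u v

/-- The collection `ℐ(F)` of independent sets of a subgraph `F` of `G`: the sets of vertices
of `F` (including the empty set) that span no edge of `F`. -/
noncomputable def indepSets {V : Type u} [Fintype V] {G : SimpleGraph V} (F : G.Subgraph) :
    Finset (Finset V) := by
  classical
  exact Finset.univ.filter
    (fun I => (∀ x ∈ I, x ∈ F.verts) ∧ ∀ x ∈ I, ∀ y ∈ I, ¬ F.Adj x y)

/-- The partition function (independence polynomial) `Z_F = ∑_{I ∈ ℐ(F)} X ^ |I|` of the
hard-core model on `F`, as a polynomial in the fugacity. -/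
noncomputable def Z {V : Type u} [Fintype V] {G : SimpleGraph V} (F : G.Subgraph) : ℝ[X] :=
  ∑ I ∈ indepSets F, (X : ℝ[X]) ^ I.card

/-- The inequality
`β · λ/(1+λ) · 1/Z_F(λ) + γ · λ Z_F'(λ)/Z_F(λ) ≥ 1`. -/
def OccupancyBound {V : Type u} [Fintype V] {G : SimpleGraph V}
    (lam b c : ℝ) (F : G.Subgraph) : Prop :=
  1 ≤ b * (lam / (1 + lam)) * (1 / (Z F).eval lam)
      + c * (lam * (derivative (Z F)).eval lam / (Z F).eval lam)

/-- The hard-core model on `G` at fugacity `lam` has local `(β_u, γ_u)_u`-occupancy: the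
occupancy bound holds for each vertex `u` and each induced subgraph `F` of `G[N(u)]`. -/
def HasLocalOccupancy {V : Type u} [Fintype V] (G : SimpleGraph V)
    (lam : ℝ) (β γ : V → ℝ) : Prop :=
  ∀ u : V, ∀ F : G.Subgraph, F.verts ⊆ G.neighborSet u → F.IsInduced →
    OccupancyBound lam (β u) (γ u) F

/-- Strong local `(β_u, γ_u)_u`-occupancy: the occupancy bound holds for each vertex `u` and
*every* subgraph `F` of `G[N(u)]`, induced or not. -/
def HasStrongLocalOccupancy {V : Type u} [Fintype V] (G : SimpleGraph V)
    (lam : ℝ) (β γ : V → ℝ) : Prop :=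
  ∀ u : V, ∀ F : G.Subgraph, F.verts ⊆ G.neighborSet u → OccupancyBound lam (β u) (γ u) F

/-- A cover `(L, H)` of `G`, where `H` is a graph with vertex set `W`. -/
structure Cover {V : Type u} (G : SimpleGraph V) (W : Type v) where
  /-- the graph of the cover -/
  H : SimpleGraph W
  /-- the lists -/
  L : V → Finset W
  /-- the lists partition the vertex set of `H` -/
  partition : ∀ x : W, ∃! u : V, x ∈ L u
  /-- each list induces a complete graph -/
  complete : ∀ u : V, ∀ x ∈ L u, ∀ y ∈ L u, x ≠ y → H.Adj x y
  /-- edges of `H` between distinct lists lie over edges of `G` -/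
  edge : ∀ u v : V, ∀ x ∈ L u, ∀ y ∈ L v, H.Adj x y → u = v ∨ G.Adj u v
  /-- over an edge `uv` of `G`, the edges of `H` form a matching: no vertex of `L u` has two
  neighbours in `L v` (and, exchanging `u` and `v`, conversely) -/
  matching : ∀ u v : V, G.Adj u v → ∀ x ∈ L u, ∀ y ∈ L v, ∀ z ∈ L v,
    H.Adj x y → H.Adj x z → y = z

/-- `G` admits an `ℋ`-colouring: `H` has an independent set of size `|V(G)|`. -/
def Cover.Colourable {V : Type u} [Fintype V] {G : SimpleGraph V} {W : Type v}
    (C : Cover G W) : Prop :=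
  ∃ I : Finset W, C.H.IsIndepSet (I : Set W) ∧ I.card = Fintype.card V

/-- The vertex set of the cover given by a list-assignment `A`: pairs of a vertex and a colour
in its list. -/
abbrev ListVertex {V : Type u} (A : V → Finset ℕ) : Type u := {p : V × ℕ // p.2 ∈ A p.1}

/-- The graph of the cover given by a list-assignment `A`: two distinct pairs are adjacent if
they have the same vertex, or adjacent vertices and the same colour. -/
def listGraph {V : Type u} (G : SimpleGraph V) (A : V → Finset ℕ) :
    SimpleGraph (ListVertex A) where
  Adj p q := p ≠ q ∧ (p.1.1 = q.1.1 ∨ (G.Adj p.1.1 q.1.1 ∧ p.1.2 = q.1.2))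
  symm := by
    refine ⟨?_⟩
    rintro p q ⟨h, h'⟩
    refine ⟨h.symm, ?_⟩
    rcases h' with h' | ⟨h1, h2⟩
    · exact Or.inl h'.symm
    · exact Or.inr ⟨h1.symm, h2.symm⟩
  loopless := by
    refine ⟨?_⟩
    rintro p ⟨h, -⟩
    exact h rfl

/-- The cover `(L, H)` arises from a list-assignment if, for some `A`, there is an isomorphism from `H` to
`listGraph G A` that maps `L(u)` onto the set of pairs with first entry `u`, for each `u`. -/
def Cover.ArisesFromList {V : Type u} {G : SimpleGraph V} {W : Type v}
    (C : Cover G W) : Prop :=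
  ∃ A : V → Finset ℕ, ∃ e : C.H ≃g listGraph G A,
    ∀ (u : V) (x : W), x ∈ C.L u ↔ (e x).1.1 = u

/-- `ℓ*_u = min_{v ∈ N(u)} ℓ_v / 8`. (For an isolated vertex `u` the value is irrelevant: the
only subgraph of `G[N(u)]` is then the null graph, which never has more than `ℓ*_u = 0`
vertices.) -/
noncomputable def ellStar {V : Type u} (G : SimpleGraph V) (l : V → ℝ) (u : V) : ℝ :=
  sInf ((fun v => l v / 8) '' G.neighborSet u)

end LocalOccupancy

/-! Draw `I` from the hard-core model on the cover graph `H` at fugacity `lam`; it is a random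
partial colouring. A colour `x` of `u` is available if `I` misses the set `crossNbrs H π x` of its
neighbours in other lists. Two bad events are attached to `u`: fewer than `ℓ` colours are available,
or some available colour has more than `θ` free neighbours, where `8 * θ ≤ ℓ` at adjacent vertices.
If no bad event occurs, the uncoloured vertices have lists of size at least `ℓ` and residual degrees
at most `ℓ / 8`, and a counting argument finishes the colouring (`IsCover.exists_transversal`).

Each bad event has probability at most `1 / (8 * D ^ 3)`, even conditionally on the outcome of
events far from `u`. By the matching condition the sets `crossNbrs H π x`, `x` in the list of `u`,
are disjoint, and given the rest of `I` each carries a hard-core model on its free part, which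
projects to a subgraph of `G[N(u)]`, induced if the cover comes from lists.

For the first event, local occupancy says that a neighbourhood is either empty with good probability
or has many occupied vertices on average. Since it passes to smaller fugacities by percolation, it
integrates to a bound on a Laplace transform (`sum_exp_le_of_occupancy`). The number of occupied
vertices over all colours of `u` is at most `deg u`, so an exponential Markov inequality, peeling
off one colour at a time (`sum_mul_prod_le`), shows that few available colours are unlikely. For the
second event, a large free part has large partition function `Z`, hence is empty with probability `1
/ Z`, and a union bound over colours suffices.

Bad events interact only within distance three, so each has at most `D ^ 3` dependencies and the
lopsided local lemma applies. -/

namespace LocalOccupancy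

section Core

open Finset
open scoped Classical

/-! ### The lopsided local lemma. -/

section

/-- The lopsided Lovász local lemma, for a finite weighted space and a common bound `p`. -/
theorem lopsided_local_lemma {Ω ι : Type*} (s : Finset Ω) (w : Ω → ℝ) (hw : ∀ ω ∈ s, 0 ≤ w ω)
    (htot : 0 < ∑ ω ∈ s, w ω) (U : Finset ι) (B : ι → Ω → Prop) (Γ : ι → Finset ι) (p : ℝ)
    (hp0 : 0 ≤ p) (hp : p ≤ 1 / 4) (hΓ : ∀ i ∈ U, ((Γ i).card : ℝ) * p ≤ 1 / 4)
    (hdep : ∀ i ∈ U, ∀ S ⊆ U, i ∉ S → Disjoint S (Γ i) →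
      ∑ ω ∈ s with (∀ j ∈ S, ¬ B j ω) ∧ B i ω, w ω ≤ p * ∑ ω ∈ s with ∀ j ∈ S, ¬ B j ω, w ω) :
    ∃ ω ∈ s, ∀ j ∈ U, ¬ B j ω := by
  set E : Finset ι → ℝ := fun S => ∑ ω ∈ s with ∀ j ∈ S, ¬ B j ω, w ω with hE
  set A : ι → Finset ι → ℝ := fun i S => ∑ ω ∈ s with (∀ j ∈ S, ¬ B j ω) ∧ B i ω, w ω with hA
  have hE0 : ∀ S, 0 ≤ E S := fun S => sum_nonneg fun ω h => hw ω (mem_filter.1 h).1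
  have hmono : ∀ i S T, T ⊆ S → A i S ≤ A i T := by
    intro i S T h
    refine sum_le_sum_of_subset_of_nonneg ?_ fun ω h _ => hw ω (mem_filter.1 h).1
    intro ω hω
    simp only [mem_filter] at hω ⊢
    exact ⟨hω.1, fun j hj => hω.2.1 j (h hj), hω.2.2⟩
  have hinsert : ∀ i S, E (insert i S) = E S - A i S := by
    intro i S
    simp only [hE, hA, sum_filter]
    rw [← sum_sub_distrib]
    refine sum_congr rfl fun ω _ => ?_
    by_cases h1 : ∀ j ∈ S, ¬ B j ω <;> by_cases h2 : B i ω <;> simp [h1, h2]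
  have hunion : ∀ (S T : Finset ι), E S - ∑ j ∈ T, A j S ≤ E (T ∪ S) := by
    intro S T
    induction T using Finset.induction_on with
    | empty => simp
    | insert i T hi ih =>
      rw [sum_insert hi, insert_union, hinsert]
      have := hmono i (T ∪ S) S subset_union_right
      linarith
  -- Dropping the events of `Γ i` from the conditioning costs at most a factor 2: by induction each
  -- has conditional weight at most `2 * p`, and `(Γ i).card * (2 * p) ≤ 1 / 2`.
  have key : ∀ n : ℕ, ∀ S ⊆ U, S.card = n → ∀ i ∈ U, i ∉ S → A i S ≤ 2 * p * E S := by
    intro n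
    induction n using Nat.strong_induction_on with
    | _ n ih =>
      intro S hS hn i hi hiS
      have h1 : A i S ≤ p * E (S \ Γ i) :=
        (hmono i S _ sdiff_subset).trans
          (hdep i hi _ (sdiff_subset.trans hS) (fun h => hiS (mem_sdiff.1 h).1) sdiff_disjoint)
      have h2 : E (S \ Γ i) ≤ 2 * E S := by
        rcases (S ∩ Γ i).eq_empty_or_nonempty with h | h
        · rw [sdiff_eq_self_of_disjoint (disjoint_iff_inter_eq_empty.2 h)]
          linarith [hE0 S]
        · have hlt : (S \ Γ i).card < n := by
            have := card_sdiff_add_card_inter S (Γ i)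
            have := h.card_pos
            omega
          have hu := hunion (S \ Γ i) (S ∩ Γ i)
          rw [union_comm, sdiff_union_inter] at hu
          have hs : ∑ j ∈ S ∩ Γ i, A j (S \ Γ i) ≤ ∑ j ∈ S ∩ Γ i, 2 * p * E (S \ Γ i) := by
            refine sum_le_sum fun j hj => ?_
            rw [mem_inter] at hj
            exact ih _ hlt _ (sdiff_subset.trans hS) rfl j (hS hj.1)
              fun h => (mem_sdiff.1 h).2 hj.2
          rw [sum_const, nsmul_eq_mul] at hs
          have hc : ((S ∩ Γ i).card : ℝ) * p ≤ 1 / 4 := by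
            refine le_trans ?_ (hΓ i hi)
            gcongr
            exact inter_subset_right
          nlinarith [hE0 (S \ Γ i)]
      nlinarith
  have hpos : ∀ S ⊆ U, 0 < E S := by
    intro S
    induction S using Finset.induction_on with
    | empty => intro _; simpa [hE] using htot
    | insert i S hi ih =>
      intro h
      have h1 := ih ((subset_insert _ _).trans h)
      have h2 := key _ S ((subset_insert _ _).trans h) rfl i (h (mem_insert_self _ _)) hi
      rw [hinsert]
      nlinarith
  have h := hpos U subset_rfl
  obtain ⟨ω, hω, -⟩ := exists_ne_zero_of_sum_ne_zero h.ne'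
  exact ⟨ω, (mem_filter.1 hω).1, (mem_filter.1 hω).2⟩

/-! ### Covers seen as projections `π : W → V`. -/

variable {V W : Type*}

/-- `(H, π)` is a cover of `G`, the lists being the fibres of `π`. -/
structure IsCover (G : SimpleGraph V) (H : SimpleGraph W) (π : W → V) : Prop where
  complete : ∀ x y, π x = π y → x ≠ y → H.Adj x y
  edge : ∀ x y, H.Adj x y → π x = π y ∨ G.Adj (π x) (π y)
  matching : ∀ x y z, π y ≠ π x → π y = π z → H.Adj x y → H.Adj x z → y = z

/-- The list over `u`. -/
noncomputable def fibre [Fintype W] (π : W → V) (u : V) : Finset W := {x | π x = u}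

/-- The neighbours of `x` outside its own list. -/
noncomputable def crossNbrs [Fintype W] (H : SimpleGraph W) (π : W → V) (x : W) : Finset W :=
  {y | H.Adj x y ∧ π y ≠ π x}

/-- The independent subsets of `T`. -/
noncomputable def indSets (H : SimpleGraph W) (T : Finset W) : Finset (Finset W) :=
  {S ∈ T.powerset | H.IsIndepSet (S : Set W)}

/-- The vertices of `T` without neighbours in `K`. -/
noncomputable def avail (H : SimpleGraph W) (K T : Finset W) : Finset W :=
  {y ∈ T | ∀ z ∈ K, ¬ H.Adj y z}

theorem mem_fibre [Fintype W] {π : W → V} {u : V} {x : W} : x ∈ fibre π u ↔ π x = u := by simp [fibre]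

theorem mem_crossNbrs [Fintype W] {H : SimpleGraph W} {π : W → V} {x y : W} :
    y ∈ crossNbrs H π x ↔ H.Adj x y ∧ π y ≠ π x := by simp [crossNbrs]

theorem mem_indSets {H : SimpleGraph W} {S T : Finset W} :
    S ∈ indSets H T ↔ S ⊆ T ∧ H.IsIndepSet (S : Set W) := by simp [indSets]

theorem mem_avail {H : SimpleGraph W} {K T : Finset W} {y : W} :
    y ∈ avail H K T ↔ y ∈ T ∧ ∀ z ∈ K, ¬ H.Adj y z := by simp [avail]

theorem avail_subset {H : SimpleGraph W} {K T : Finset W} : avail H K T ⊆ T :=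
  fun _ h => (mem_avail.1 h).1

end

/-! ### The hard-core model: Markov property, percolation, Laplace transform. -/

section

variable {V W : Type*} {H : SimpleGraph W}

theorem empty_mem_indSets (H : SimpleGraph W) (T : Finset W) : ∅ ∈ indSets H T := by
  simp [mem_indSets, SimpleGraph.IsIndepSet]

theorem isIndepSet_union {S K : Finset W} (hS : H.IsIndepSet (S : Set W))
    (hK : H.IsIndepSet (K : Set W)) (h : ∀ y ∈ S, ∀ z ∈ K, ¬ H.Adj y z) :
    H.IsIndepSet ((S ∪ K : Finset W) : Set W) := by
  intro a ha b hb hab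
  simp only [mem_coe, mem_union] at ha hb
  rcases ha with ha | ha <;> rcases hb with hb | hb
  · exact hS ha hb hab
  · exact h a ha b hb
  · exact fun hadj => h b hb a ha hadj.symm
  · exact hK ha hb hab

theorem isIndepSet_mono {S K : Finset W} (hS : H.IsIndepSet (S : Set W)) (h : K ⊆ S) :
    H.IsIndepSet (K : Set W) :=
  Set.Pairwise.mono (by exact_mod_cast h) hS

/-- The spatial Markov property of the hard-core model. -/
theorem sum_indSets_split [Fintype W] (H : SimpleGraph W) (Λ : Finset W)
    (f : Finset W → Finset W → ℝ) :
    ∑ I ∈ indSets H univ, f (I \ Λ) (I ∩ Λ) =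
      ∑ K ∈ indSets H Λᶜ, ∑ S ∈ indSets H (avail H K Λ), f K S := by
  rw [sum_sigma']
  refine sum_bij' (fun I _ => ⟨I \ Λ, I ∩ Λ⟩) (fun p _ => p.2 ∪ p.1) ?_ ?_ ?_ ?_ ?_
  · intro I hI
    have hI := (mem_indSets.1 hI).2
    simp only [mem_sigma, mem_indSets]
    refine ⟨⟨fun x hx => ?_, isIndepSet_mono hI sdiff_subset⟩, fun x hx => ?_,
      isIndepSet_mono hI inter_subset_left⟩
    · simpa using (mem_sdiff.1 hx).2
    · rw [mem_inter] at hx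
      refine mem_avail.2 ⟨hx.2, fun z hz hadj => ?_⟩
      exact hI (by simpa using hx.1) (by simpa using (mem_sdiff.1 hz).1) hadj.ne hadj
  · rintro ⟨K, S⟩ hp
    simp only [mem_sigma, mem_indSets] at hp
    refine mem_indSets.2 ⟨subset_univ _, isIndepSet_union hp.2.2 hp.1.2 fun y hy z hz => ?_⟩
    exact (mem_avail.1 (hp.2.1 hy)).2 z hz
  · intro I _
    ext x
    simp only [mem_union, mem_inter, mem_sdiff]
    tauto
  · rintro ⟨K, S⟩ hp
    simp only [mem_sigma, mem_indSets] at hp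
    have h1 : ∀ x ∈ K, x ∉ Λ := fun x hx => by simpa using hp.1.1 hx
    have h2 : ∀ x ∈ S, x ∈ Λ := fun x hx => (mem_avail.1 (hp.2.1 hx)).1
    have e1 : (S ∪ K) \ Λ = K := by
      ext x
      simp only [mem_union, mem_sdiff]
      have := h1 x
      have := h2 x
      tauto
    have e2 : (S ∪ K) ∩ Λ = S := by
      ext x
      simp only [mem_union, mem_inter]
      have := h1 x
      have := h2 x
      tauto
    simp only [e1, e2]
  · intro I _
    rfl

/-- A bound for the hard-core weight on `Λ`, conditional on the rest, integrates. -/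
theorem sum_indSets_le_of_conditional [Fintype W] (H : SimpleGraph W) (Λ : Finset W) (lam : ℝ)
    (hlam : 0 < lam) (c : ℝ) (f g : Finset W → Finset W → ℝ)
    (h : ∀ K ∈ indSets H Λᶜ, ∑ S ∈ indSets H (avail H K Λ), lam ^ S.card * f K S ≤
      c * ∑ S ∈ indSets H (avail H K Λ), lam ^ S.card * g K S) :
    ∑ I ∈ indSets H univ, lam ^ I.card * f (I \ Λ) (I ∩ Λ) ≤
      c * ∑ I ∈ indSets H univ, lam ^ I.card * g (I \ Λ) (I ∩ Λ) := by
  have key : ∀ f : Finset W → Finset W → ℝ,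
      ∑ I ∈ indSets H univ, lam ^ I.card * f (I \ Λ) (I ∩ Λ) = ∑ K ∈ indSets H Λᶜ,
        lam ^ K.card * ∑ S ∈ indSets H (avail H K Λ), lam ^ S.card * f K S := by
    intro f
    have := sum_indSets_split H Λ (fun K S => lam ^ (K.card + S.card) * f K S)
    simp only [card_sdiff_add_card_inter] at this
    rw [this]
    refine sum_congr rfl fun K _ => ?_
    rw [mul_sum]
    exact sum_congr rfl fun S _ => by rw [pow_add, mul_assoc]
  rw [key, key, mul_sum]
  refine sum_le_sum fun K hK => ?_
  have := mul_le_mul_of_nonneg_left (h K hK) (pow_nonneg hlam.le K.card)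
  linarith

/-- Percolation: the average over random subsets of `T` of a sum over independent subsets. -/
theorem sum_powerset_percolation (H : SimpleGraph W) (T : Finset W) (q : ℝ)
    (f : Finset W → ℝ) :
    ∑ A ∈ T.powerset, q ^ A.card * (1 - q) ^ (T.card - A.card) * ∑ S ∈ indSets H A, f S =
      ∑ S ∈ indSets H T, q ^ S.card * f S := by
  have h1 : ∀ A ∈ T.powerset, q ^ A.card * (1 - q) ^ (T.card - A.card) * ∑ S ∈ indSets H A, f S =
      ∑ S ∈ indSets H T, if S ⊆ A then q ^ A.card * (1 - q) ^ (T.card - A.card) * f S else 0 := by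
    intro A hA
    rw [mul_sum, ← sum_filter]
    refine sum_congr ?_ fun _ _ => rfl
    ext S
    simp only [mem_filter, mem_indSets]
    have := mem_powerset.1 hA
    exact ⟨fun h => ⟨⟨h.1.trans this, h.2⟩, h.1⟩, fun h => ⟨h.2, h.1.2⟩⟩
  rw [sum_congr rfl h1, sum_comm]
  refine sum_congr rfl fun S hS => ?_
  have hST := (mem_indSets.1 hS).1
  rw [← sum_filter]
  -- The sets `A` containing `S` correspond to subsets of `T \ S`, whose binomial weights sum to 1.
  have h2 : ∑ A ∈ T.powerset with S ⊆ A, q ^ A.card * (1 - q) ^ (T.card - A.card) * f S =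
      ∑ A ∈ (T \ S).powerset,
        q ^ S.card * f S * (q ^ A.card * (1 - q) ^ ((T \ S).card - A.card)) := by
    refine sum_bij' (fun A _ => A \ S) (fun A _ => A ∪ S) ?_ ?_ ?_ ?_ ?_
    · intro A hA
      simp only [mem_filter, mem_powerset] at hA ⊢
      exact sdiff_subset_sdiff hA.1 subset_rfl
    · intro A hA
      simp only [mem_filter, mem_powerset] at hA ⊢
      exact ⟨union_subset (hA.trans sdiff_subset) hST, subset_union_right⟩
    · intro A hA
      exact sdiff_union_of_subset (mem_filter.1 hA).2
    · intro A hA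
      rw [union_sdiff_right]
      exact sdiff_eq_self_of_disjoint (disjoint_of_subset_left (mem_powerset.1 hA) sdiff_disjoint)
    · intro A hA
      simp only [mem_filter, mem_powerset] at hA
      have e1 := card_sdiff_add_card_eq_card hA.2
      have e2 := card_sdiff_add_card_eq_card hST
      have e3 : T.card - A.card = (T \ S).card - (A \ S).card := by omega
      rw [e3, ← e1, pow_add]
      ring
  rw [h2, ← mul_sum, sum_pow_mul_eq_add_pow]
  simp

/-- Occupancy at fugacity `lam` for all subsets gives occupancy at all smaller fugacities. -/
theorem occupancy_of_le (T : Finset W) (lam z b c : ℝ) (hlam : 0 < lam) (hz : 0 ≤ z)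
    (hz' : z ≤ lam)
    (h : ∀ A ⊆ T, ∑ S ∈ indSets H A, (1 - c * S.card) * lam ^ S.card ≤ b) :
    ∑ S ∈ indSets H T, (1 - c * S.card) * z ^ S.card ≤ b := by
  have h0 : 0 ≤ z / lam := by positivity
  have h1 : z / lam ≤ 1 := (div_le_one hlam).2 hz'
  have e := sum_powerset_percolation H T (z / lam) fun S => (1 - c * S.card) * lam ^ S.card
  have e' : ∑ S ∈ indSets H T, (1 - c * S.card) * z ^ S.card =
      ∑ S ∈ indSets H T, (z / lam) ^ S.card * ((1 - c * S.card) * lam ^ S.card) := by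
    refine sum_congr rfl fun S _ => ?_
    rw [div_pow]
    field_simp
  rw [e', ← e]
  calc _ ≤ ∑ A ∈ T.powerset, (z / lam) ^ A.card * (1 - z / lam) ^ (T.card - A.card) * b := by
        refine sum_le_sum fun A hA => mul_le_mul_of_nonneg_left (h A (mem_powerset.1 hA)) ?_
        exact mul_nonneg (pow_nonneg h0 _) (pow_nonneg (by linarith) _)
    _ = b := by rw [← sum_mul, sum_pow_mul_eq_add_pow]; simp

/-- Local occupancy integrates to a bound on the Laplace transform of the number of occupied
vertices. -/
theorem sum_exp_le_of_occupancy (T : Finset W) (lam b c s : ℝ) (hlam : 0 < lam) (hc : 0 < c)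
    (hs : 0 ≤ s)
    (h : ∀ A ⊆ T, ∑ S ∈ indSets H A, (1 - c * S.card) * lam ^ S.card ≤ b) :
    ∑ S ∈ indSets H T, lam ^ S.card * Real.exp (-s * S.card) ≤
      b + Real.exp (-s / c) * (∑ S ∈ indSets H T, lam ^ S.card - b) := by
  set k : ℝ → ℝ := fun t =>
    (∑ S ∈ indSets H T, lam ^ S.card * Real.exp (-t * S.card) - b) * Real.exp (t / c) with hk
  have hd : ∀ t, HasDerivAt k
      ((∑ S ∈ indSets H T, lam ^ S.card * (Real.exp (-t * S.card) * (-1 * S.card)))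
          * Real.exp (t / c) +
        (∑ S ∈ indSets H T, lam ^ S.card * Real.exp (-t * S.card) - b)
          * (Real.exp (t / c) * (1 / c))) t := by
    intro t
    have h1 : HasDerivAt (fun t : ℝ => ∑ S ∈ indSets H T, lam ^ S.card * Real.exp (-t * S.card) - b)
        (∑ S ∈ indSets H T, lam ^ S.card * (Real.exp (-t * S.card) * (-1 * S.card))) t := by
      refine HasDerivAt.sub_const _ (HasDerivAt.fun_sum fun S _ => ?_)
      exact ((((hasDerivAt_id t).neg).mul_const _).exp).const_mul _
    exact h1.mul (((hasDerivAt_id t).div_const c).exp)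
  -- Writing `P t` for the sum in `k`, occupancy at fugacity `lam * exp (-t)` reads `P + c * P' ≤
  -- b`; `exp (t / c)` is the integrating factor.
  have hanti : AntitoneOn k (Set.Ici 0) := by
    refine antitoneOn_of_deriv_nonpos (convex_Ici 0)
      (fun t _ => (hd t).continuousAt.continuousWithinAt)
      (fun t _ => (hd t).differentiableAt.differentiableWithinAt) fun t ht => ?_
    rw [interior_Ici, Set.mem_Ioi] at ht
    rw [(hd t).deriv]
    have hocc := occupancy_of_le T lam (lam * Real.exp (-t)) b c hlam (by positivity)
      (mul_le_of_le_one_right hlam.le (Real.exp_le_one_iff.2 (by linarith))) h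
    have e : ∑ S ∈ indSets H T, (1 - c * S.card) * (lam * Real.exp (-t)) ^ S.card =
        ∑ S ∈ indSets H T, lam ^ S.card * Real.exp (-t * S.card) +
        c * ∑ S ∈ indSets H T, lam ^ S.card * (Real.exp (-t * S.card) * (-1 * S.card)) := by
      rw [mul_sum, ← sum_add_distrib]
      refine sum_congr rfl fun S _ => ?_
      rw [mul_pow, ← Real.exp_nat_mul, mul_comm (S.card : ℝ) (-t)]
      ring
    rw [e] at hocc
    have hpos : 0 < Real.exp (t / c) / c := by positivity
    set P := ∑ S ∈ indSets H T, lam ^ S.card * Real.exp (-t * S.card)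
    set Q := ∑ S ∈ indSets H T, lam ^ S.card * (Real.exp (-t * S.card) * (-1 * S.card))
    have : Q * Real.exp (t / c) + (P - b) * (Real.exp (t / c) * (1 / c)) =
        (Real.exp (t / c) / c) * (P + c * Q - b) := by
      field_simp
      ring
    rw [this]
    exact mul_nonpos_of_nonneg_of_nonpos hpos.le (by linarith)
  have := hanti (Set.mem_Ici.2 le_rfl) (Set.mem_Ici.2 hs) hs
  simp only [hk, neg_zero, zero_mul, Real.exp_zero, mul_one, zero_div] at this
  have h2 : Real.exp (-s / c) * Real.exp (s / c) = 1 := by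
    rw [← Real.exp_add]; simp [neg_div]
  have h3 := mul_le_mul_of_nonneg_left this (Real.exp_pos (-s / c)).le
  rw [mul_left_comm, h2, mul_one] at h3
  linarith

/-- With `t = -log (1 - x)` this is exactly `t ≤ sinh t`. -/
theorem neg_half_sq_bound (x : ℝ) (h0 : 0 < x) (h1 : x < 1) :
    -x - (1 - x) * Real.log (1 - x) ≤ -x ^ 2 / 2 := by
  have hy : 0 < 1 - x := by linarith
  have hl : 0 ≤ Real.log (1 - x)⁻¹ :=
    Real.log_nonneg ((one_le_inv₀ hy).2 (by linarith))
  have h := Real.self_le_sinh_iff.2 hl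
  rw [Real.sinh_log (by positivity), Real.log_inv, inv_inv] at h
  have h2 := mul_le_mul_of_nonneg_left h hy.le
  have h3 : (1 - x) * (((1 - x)⁻¹ - (1 - x)) / 2) = (1 - (1 - x) ^ 2) / 2 := by
    field_simp
  rw [h3] at h2
  nlinarith

end

/-! ### Completing partial colourings: counting transversals and greedy colouring. -/

section

variable {V W : Type*} {G : SimpleGraph V} {H : SimpleGraph W} {π : W → V}

/-- The independent subsets of `A` meeting exactly the lists over `S`. -/
noncomputable def transversals (H : SimpleGraph W) (π : W → V) (A : Finset W) (S : Finset V) :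
    Finset (Finset W) :=
  {R ∈ indSets H A | R.image π = S}

theorem mem_transversals {A R : Finset W} {S : Finset V} :
    R ∈ transversals H π A S ↔ (R ⊆ A ∧ H.IsIndepSet (R : Set W)) ∧ R.image π = S := by
  simp [transversals, mem_indSets]

theorem IsCover.eq_of_isIndepSet (hc : IsCover G H π) {R : Finset W}
    (hR : H.IsIndepSet (R : Set W)) {x y : W} (hx : x ∈ R) (hy : y ∈ R) (h : π x = π y) :
    x = y := by
  by_contra hne
  exact hR hx hy hne (hc.complete x y h hne)

/-- Deleting `y` is injective on the transversals that contain it. -/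
theorem IsCover.card_transversals_mem_le (hc : IsCover G H π) (A : Finset W) (S : Finset V)
    (y : W) :
    #{R ∈ transversals H π A S | y ∈ R} ≤ #(transversals H π A (S.erase (π y))) := by
  refine card_le_card_of_injOn (fun R => R.erase y) ?_ ?_
  · intro R hR
    simp only [coe_filter, Set.mem_ofPred_eq, mem_transversals] at hR
    obtain ⟨⟨⟨h1, h2⟩, h3⟩, h4⟩ := hR
    simp only [mem_coe, mem_transversals]
    refine ⟨⟨(erase_subset _ _).trans h1, isIndepSet_mono h2 (erase_subset _ _)⟩, ?_⟩
    ext v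
    simp only [mem_image, mem_erase, ← h3]
    constructor
    · rintro ⟨x, ⟨hxy, hx⟩, rfl⟩
      exact ⟨fun h => hxy (hc.eq_of_isIndepSet h2 hx h4 h), x, hx, rfl⟩
    · rintro ⟨hv, x, hx, rfl⟩
      exact ⟨x, ⟨fun h => hv (by rw [h]), hx⟩, rfl⟩
  · intro R hR R' hR' h
    simp only [coe_filter, Set.mem_ofPred_eq] at hR hR'
    simp only at h
    rw [← insert_erase hR.2, h, insert_erase hR'.2]

variable [Fintype W]

/-- A pair (transversal, colour of `u`) either glues to a larger transversal or has a conflict at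
some neighbour `y` of the colour. -/
theorem card_transversals_mul_le (A : Finset W) (S : Finset V)
    {u : V} (hu : u ∉ S) :
    #(transversals H π A S) * #(A ∩ fibre π u) ≤ #(transversals H π A (insert u S)) +
      ∑ x ∈ A ∩ fibre π u, ∑ y ∈ A ∩ crossNbrs H π x,
        #{R ∈ transversals H π A S | y ∈ R} := by
  rw [← card_product, ← card_filter_add_card_filter_not (fun p : Finset W × W =>
    ∀ y ∈ p.1, ¬ H.Adj p.2 y)]
  refine add_le_add ?_ ?_
  · refine card_le_card_of_injOn (fun p => insert p.2 p.1) ?_ ?_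
    · rintro ⟨R, x⟩ hp
      simp only [coe_filter, mem_product, Set.mem_ofPred_eq, mem_transversals, mem_inter,
        mem_fibre] at hp
      obtain ⟨⟨⟨⟨h1, h2⟩, h3⟩, hxA, hxu⟩, h4⟩ := hp
      simp only [mem_coe, mem_transversals]
      refine ⟨⟨insert_subset hxA h1, ?_⟩, by rw [image_insert, h3, hxu]⟩
      rw [insert_eq]
      refine isIndepSet_union (by simp [SimpleGraph.IsIndepSet]) h2 ?_
      intro y hy z hz
      rw [mem_singleton] at hy
      exact hy ▸ h4 z hz
    · rintro ⟨R, x⟩ hp ⟨R', x'⟩ hp' h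
      simp only [coe_filter, mem_product, Set.mem_ofPred_eq, mem_transversals, mem_inter,
        mem_fibre] at hp hp' h
      have hnot : ∀ z ∈ R, π z ≠ u := fun z hz h => hu (hp.1.1.2 ▸ h ▸ mem_image_of_mem π hz)
      have hnot' : ∀ z ∈ R', π z ≠ u := fun z hz h => hu (hp'.1.1.2 ▸ h ▸ mem_image_of_mem π hz)
      have hxx : x = x' := by
        have : x ∈ insert x' R' := h ▸ mem_insert_self x R
        rcases mem_insert.1 this with h | h
        · exact h
        · exact absurd hp.1.2.2 (hnot' x h)
      subst hxx
      have hR : x ∉ R := fun h => hnot x h hp.1.2.2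
      have hR' : x ∉ R' := fun h => hnot' x h hp.1.2.2
      rw [← erase_insert hR, h, erase_insert hR']
  · rw [card_eq_sum_card_fiberwise (f := Prod.snd) (t := A ∩ fibre π u)]
    · refine sum_le_sum fun x hx => ?_
      rw [mem_inter, mem_fibre] at hx
      refine le_trans ?_ card_biUnion_le
      refine card_le_card_of_injOn Prod.fst ?_ ?_
      · rintro ⟨R, x'⟩ hp
        simp only [coe_filter, mem_filter, mem_product, Set.mem_ofPred_eq] at hp
        obtain ⟨⟨⟨hR, -⟩, hbad⟩, rfl⟩ := hp
        push Not at hbad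
        obtain ⟨y, hy, hadj⟩ := hbad
        have hR' := mem_transversals.1 hR
        simp only [coe_biUnion, Set.mem_iUnion, mem_coe, mem_filter]
        refine ⟨y, ?_, hR, hy⟩
        rw [mem_inter, mem_crossNbrs]
        refine ⟨hR'.1.1 hy, hadj, fun h => hu ?_⟩
        rw [← hx.2, ← h, ← hR'.2]
        exact mem_image_of_mem π hy
      · rintro ⟨R, x1⟩ hp ⟨R', x2⟩ hp' h
        simp only [coe_filter, mem_filter, Set.mem_ofPred_eq] at hp hp' h
        rw [h, hp.2, hp'.2]
    · intro p hp
      simp only [coe_filter, mem_product, Set.mem_ofPred_eq] at hp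
      exact hp.1.2

/-- Large lists and small residual degrees suffice for an independent transversal. -/
theorem IsCover.exists_transversal (hc : IsCover G H π) (A : Finset W) (U : Finset V)
    (ℓ : V → ℝ) (hℓ : ∀ u ∈ U, 0 < ℓ u) (hA : ∀ x ∈ A, π x ∈ U)
    (hlist : ∀ u ∈ U, ℓ u ≤ #(A ∩ fibre π u))
    (hdeg : ∀ x ∈ A, ∀ y ∈ A ∩ crossNbrs H π x, 8 * (#(A ∩ crossNbrs H π x) : ℝ) ≤ ℓ (π y)) :
    ∃ R ⊆ A, H.IsIndepSet (R : Set W) ∧ R.image π = U := by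
  -- Each new list multiplies the count by at least `ℓ u / 2`. By induction, transversals through
  -- `y` are at most a fraction `2 / ℓ (π y)` of all, hence at most `1 / (4 * #N)`; so every colour
  -- conflicts with at most a quarter of the transversals.
  have key : ∀ n : ℕ, ∀ S ⊆ U, #S = n → ∀ u ∈ U, u ∉ S →
      ℓ u / 2 * #(transversals H π A S) ≤ #(transversals H π A (insert u S)) := by
    intro n
    induction n using Nat.strong_induction_on with
    | _ n ih =>
      intro S hS hn u hu huS
      have h1 := card_transversals_mul_le (H := H) (π := π) A S huS
      have h1' : (#(transversals H π A S) : ℝ) * #(A ∩ fibre π u) ≤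
          #(transversals H π A (insert u S)) + ∑ x ∈ A ∩ fibre π u, ∑ y ∈ A ∩ crossNbrs H π x,
            (#{R ∈ transversals H π A S | y ∈ R} : ℝ) := by exact_mod_cast h1
      have h2 : ∀ x ∈ A ∩ fibre π u, ∑ y ∈ A ∩ crossNbrs H π x,
          (#{R ∈ transversals H π A S | y ∈ R} : ℝ) ≤ #(transversals H π A S) / 4 := by
        intro x hx
        set N := A ∩ crossNbrs H π x with hN
        rcases N.eq_empty_or_nonempty with h0 | h0
        · rw [h0, sum_empty]; positivity
        have hNpos : (0 : ℝ) < #N := by exact_mod_cast h0.card_pos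
        have : ∀ y ∈ N, (#{R ∈ transversals H π A S | y ∈ R} : ℝ) ≤
            #(transversals H π A S) / (4 * #N) := by
          intro y hy
          have hyA : y ∈ A := (mem_inter.1 hy).1
          have hd := hdeg x (mem_inter.1 hx).1 y hy
          by_cases hyS : π y ∈ S
          · have h3 : (#{R ∈ transversals H π A S | y ∈ R} : ℝ) ≤
                #(transversals H π A (S.erase (π y))) := by
              exact_mod_cast hc.card_transversals_mem_le A S y
            have h4 := ih _ (hn ▸ card_erase_lt_of_mem hyS) (S.erase (π y))
              ((erase_subset _ _).trans hS) rfl (π y) (hA y hyA) (notMem_erase _ _)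
            rw [insert_erase hyS] at h4
            rw [le_div_iff₀ (by positivity)]
            have h5 : (0 : ℝ) ≤ #(transversals H π A (S.erase (π y))) := by positivity
            nlinarith
          · have : {R ∈ transversals H π A S | y ∈ R} = ∅ := by
              refine filter_eq_empty_iff.2 fun R hR hy => hyS ?_
              rw [← (mem_transversals.1 hR).2]
              exact mem_image_of_mem π hy
            rw [this]
            simp only [card_empty, CharP.cast_eq_zero]
            positivity
        refine (sum_le_sum this).trans (le_of_eq ?_)
        rw [sum_const, nsmul_eq_mul]
        field_simp
      have h3 := sum_le_sum h2
      rw [sum_const, nsmul_eq_mul] at h3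
      have h4 := hlist u hu
      have h5 : (0 : ℝ) ≤ #(transversals H π A S) := by positivity
      nlinarith [hℓ u hu]
  have hpos : ∀ S ⊆ U, (0 : ℝ) < #(transversals H π A S) := by
    intro S
    induction S using Finset.induction_on with
    | empty =>
      intro _
      have : ∅ ∈ transversals H π A ∅ := by
        simp [mem_transversals, SimpleGraph.IsIndepSet]
      exact_mod_cast card_pos.2 ⟨_, this⟩
    | insert u S hu ih =>
      intro h
      have h1 := ih ((subset_insert _ _).trans h)
      have h2 := hℓ u (h (mem_insert_self _ _))
      have h3 := key _ S ((subset_insert _ _).trans h) rfl u (h (mem_insert_self _ _)) hu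
      have : 0 < ℓ u / 2 * #(transversals H π A S) := by positivity
      linarith
  obtain ⟨R, hR⟩ := card_pos.1 (Nat.cast_pos.1 (hpos U subset_rfl))
  rw [mem_transversals] at hR
  exact ⟨R, hR.1.1, hR.1.2, hR.2⟩

/-- Vertices with more colours than neighbours can be coloured last. -/
theorem IsCover.exists_full [Fintype V] [DecidableRel G.Adj] (hc : IsCover G H π) (D : ℕ)
    (hD : ∀ u, G.degree u ≤ D) (I : Finset W) (hI : H.IsIndepSet (I : Set W))
    (hcov : ∀ u, #(fibre π u) ≤ D → ∃ x ∈ I, π x = u) :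
    ∃ J : Finset W, H.IsIndepSet (J : Set W) ∧ #J = Fintype.card V := by
  obtain ⟨J, hJ, hmax⟩ := exists_max_image
    ({J ∈ indSets H univ | I ⊆ J}) card ⟨I, by simp [mem_indSets, hI]⟩
  simp only [mem_filter, mem_indSets, subset_univ, true_and] at hJ hmax
  have hsurj : ∀ u, ∃ x ∈ J, π x = u := by
    intro u
    by_contra hu
    push Not at hu
    have hbig : D < #(fibre π u) := by
      by_contra h
      obtain ⟨x, hx, hxu⟩ := hcov u (not_lt.1 h)
      exact hu x (hJ.2 hx) hxu
    have hex : ∃ x ∈ fibre π u, ∀ z ∈ J, ¬ H.Adj x z := by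
      by_contra hno
      push Not at hno
      -- If every colour of `u` has a blocker in `J`, the blockers lie over distinct neighbours of
      -- `u` by the matching condition, so the list is no larger than the degree.
      choose! f hf hadj using hno
      have : #(fibre π u) ≤ #(G.neighborFinset u) := by
        refine card_le_card_of_injOn (fun x => π (f x)) ?_ ?_
        · intro x hx
          have hx' := mem_fibre.1 (mem_coe.1 hx)
          rcases hc.edge _ _ (hadj x hx) with h | h
          · exact absurd (h.symm.trans hx') (hu _ (hf x hx))
          · simpa [hx'] using h
        · intro x hx y hy h
          have hx' := mem_fibre.1 (mem_coe.1 hx)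
          have hy' := mem_fibre.1 (mem_coe.1 hy)
          have e := hc.eq_of_isIndepSet hJ.1 (hf x hx) (hf y hy) h
          refine hc.matching (f x) x y ?_ (hx'.trans hy'.symm) (hadj x hx).symm ?_
          · rw [hx']; exact (hu _ (hf x hx)).symm
          · rw [e]; exact (hadj y hy).symm
      rw [SimpleGraph.card_neighborFinset_eq_degree] at this
      exact absurd (this.trans (hD u)) (not_le.2 hbig)
    obtain ⟨x, hx, hfree⟩ := hex
    have hxJ : x ∉ J := fun h => hu x h (mem_fibre.1 hx)
    have := hmax (insert x J) ⟨?_, hJ.2.trans (subset_insert _ _)⟩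
    · rw [card_insert_of_notMem hxJ] at this
      omega
    · rw [insert_eq]
      refine isIndepSet_union (by simp [SimpleGraph.IsIndepSet]) hJ.1 ?_
      intro y hy z hz
      rw [mem_singleton] at hy
      exact hy ▸ hfree z hz
  refine ⟨J, hJ.1, ?_⟩
  refine card_bij (fun x _ => π x) (fun _ _ => mem_univ _)
    (fun x hx y hy h => hc.eq_of_isIndepSet hJ.1 hx hy h) fun u _ => ?_
  obtain ⟨x, hx, h⟩ := hsurj u
  exact ⟨x, hx, h⟩

end

/-! ### Probabilities of the two bad events. -/

section

variable {V W : Type*} {G : SimpleGraph V} {H : SimpleGraph W} {π : W → V}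

/-- The tilting weight of an occupied set. -/
noncomputable def tilt (η s : ℝ) (S : Finset W) : ℝ :=
  (if S = ∅ then 1 - η else 1) * Real.exp (-s * S.card)

/-- The factor `1 - η` at `∅` subtracts exactly `η`. The exponent is chosen so that the Laplace
bound reads `b + (1 - η / b) * (Z - b) = (1 - η / b) * Z + η`, and the two `η` cancel. -/
theorem sum_tilt_le (T : Finset W) (lam b c η : ℝ) (hlam : 0 < lam) (hc : 0 < c) (hη : 0 < η)
    (hη1 : η < 1) (hb : 1 ≤ b)
    (h : ∀ A ⊆ T, ∑ S ∈ indSets H A, (1 - c * S.card) * lam ^ S.card ≤ b) :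
    ∑ S ∈ indSets H T, lam ^ S.card * tilt η (-c * Real.log (1 - η / b)) S ≤
      (1 - η / b) * ∑ S ∈ indSets H T, lam ^ S.card := by
  have hηb : η / b ≤ η := div_le_self hη.le hb
  have hηb0 : 0 < η / b := by positivity
  have hs : 0 ≤ -c * Real.log (1 - η / b) := by
    have := Real.log_nonpos (x := 1 - η / b) (by linarith) (by linarith)
    nlinarith
  have h1 := sum_exp_le_of_occupancy T lam b c _ hlam hc hs h
  have h2 : Real.exp (-(-c * Real.log (1 - η / b)) / c) = 1 - η / b := by
    rw [neg_mul, neg_neg, mul_div_cancel_left₀ _ hc.ne', Real.exp_log (by linarith)]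
  rw [h2] at h1
  set s := -c * Real.log (1 - η / b)
  have h3 : ∑ S ∈ indSets H T, lam ^ S.card * tilt η s S =
      ∑ S ∈ indSets H T, lam ^ S.card * Real.exp (-s * S.card) - η := by
    have : ∀ S ∈ indSets H T, lam ^ S.card * tilt η s S =
        lam ^ S.card * Real.exp (-s * S.card) - if S = ∅ then η else 0 := by
      intro S _
      unfold tilt
      split_ifs with h0
      · subst h0; simp
      · ring
    rw [sum_congr rfl this, sum_sub_distrib, sum_ite_eq' , if_pos (empty_mem_indSets H T)]
  rw [h3]
  have h4 : η / b * b = η := div_mul_cancel₀ _ (by linarith)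
  nlinarith

/-- Let `μ = (L - c * d) / b`. After taking logarithms, `log (1 - η / b) ≤ -η / b` and `ℓ ≤ (1 - η)
* μ` reduce the claim to `neg_half_sq_bound` times `μ`; then `μ * η ^ 2 / 2 ≥ 3 * log (2 * D)`
produces the factor `1 / (8 * D ^ 3)`. -/
theorem tail_bound (L D : ℕ) (d ℓ η b c : ℝ) (hD : 1 ≤ D) (hℓ : 0 < ℓ) (hη : 0 < η)
    (hη1 : η < 1) (hb : 1 ≤ b) (h1 : ℓ / (1 - η) ≤ (L - c * d) / b)
    (h2 : 6 * Real.log (2 * D) / η ^ 2 ≤ (L - c * d) / b) :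
    (1 - η / b) ^ L ≤ 1 / (8 * (D : ℝ) ^ 3) *
      ((1 - η) ^ ℓ * Real.exp (-(-c * Real.log (1 - η / b)) * d)) := by
  set μ := (L - c * d) / b with hμ
  have hη' : 0 < 1 - η := by linarith
  have hηb : η / b ≤ η := div_le_self hη.le hb
  have hb0 : 0 < b := by linarith
  have hc0 : 0 < 1 - η / b := by linarith
  have hD0 : (0 : ℝ) < D := by exact_mod_cast hD
  have hμ0 : 0 < μ := (by positivity : 0 < ℓ / (1 - η)).trans_le h1
  have hlogc : Real.log (1 - η / b) ≤ -(η / b) := by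
    have := Real.log_le_sub_one_of_pos hc0
    linarith
  have e1 : (1 - η / b) ^ L = Real.exp (L * Real.log (1 - η / b)) := by
    rw [Real.exp_nat_mul, Real.exp_log hc0]
  have e2 : 1 / (8 * (D : ℝ) ^ 3) = Real.exp (-(3 * Real.log (2 * D))) := by
    rw [Real.exp_neg, show (3 : ℝ) = (3 : ℕ) by norm_num, Real.exp_nat_mul,
      Real.exp_log (by positivity), one_div]
    congr 1
    ring
  rw [e1, e2, Real.rpow_def_of_pos hη', ← Real.exp_add, ← Real.exp_add, Real.exp_le_exp]
  have hLμ : (L : ℝ) - c * d = μ * b := by rw [hμ, div_mul_cancel₀ _ hb0.ne']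
  have i1 : (L - c * d) * Real.log (1 - η / b) ≤ -(η * μ) := by
    rw [hLμ]
    calc μ * b * Real.log (1 - η / b) ≤ μ * b * -(η / b) :=
          mul_le_mul_of_nonneg_left hlogc (by positivity)
      _ = -(η * μ) := by field_simp
  have i2 : (1 - η) * μ * Real.log (1 - η) ≤ Real.log (1 - η) * ℓ := by
    rw [div_le_iff₀ hη'] at h1
    have := Real.log_nonpos hη'.le (by linarith)
    nlinarith
  have i3 := mul_le_mul_of_nonneg_left (neg_half_sq_bound η hη hη1) hμ0.le
  have i4 : 6 * Real.log (2 * D) ≤ μ * η ^ 2 := (div_le_iff₀ (by positivity)).1 h2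
  nlinarith

variable [Fintype W]

/-- Peeling off conditionally bounded factors on disjoint sets one by one. -/
theorem sum_mul_prod_le (H : SimpleGraph W) (Λ : W → Finset W) (lam c : ℝ) (hlam : 0 < lam)
    (hc : 0 ≤ c) (φ : Finset W → ℝ) (hφ : ∀ S, 0 ≤ φ S) (g : Finset W → ℝ) (hg : ∀ I, 0 ≤ g I)
    (X : Finset W) (hgX : ∀ x ∈ X, ∀ I, g (I \ Λ x) = g I)
    (hdisj : ∀ x ∈ X, ∀ y ∈ X, x ≠ y → Disjoint (Λ x) (Λ y))
    (hloc : ∀ x ∈ X, ∀ T ⊆ Λ x, ∑ S ∈ indSets H T, lam ^ S.card * φ S ≤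
      c * ∑ S ∈ indSets H T, lam ^ S.card) :
    ∑ I ∈ indSets H univ, lam ^ I.card * (g I * ∏ x ∈ X, φ (I ∩ Λ x)) ≤
      c ^ X.card * ∑ I ∈ indSets H univ, lam ^ I.card * g I := by
  induction X using Finset.induction_on with
  | empty => simp
  | insert x X hx ih =>
    have ih' := ih (fun y hy => hgX y (mem_insert_of_mem hy))
      (fun y hy z hz => hdisj y (mem_insert_of_mem hy) z (mem_insert_of_mem hz))
      (fun y hy => hloc y (mem_insert_of_mem hy))
    set g' : Finset W → ℝ := fun I => g I * ∏ y ∈ X, φ (I ∩ Λ y) with hg'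
    -- All the other factors ignore `Λ x`, so they are constant once `I \ Λ x` is fixed.
    have hinv : ∀ I, g' (I \ Λ x) = g' I := by
      intro I
      simp only [hg', hgX x (mem_insert_self _ _)]
      congr 1
      refine prod_congr rfl fun y hy => ?_
      congr 1
      have hd := hdisj y (mem_insert_of_mem hy) x (mem_insert_self _ _) (fun h => hx (h ▸ hy))
      ext z
      have hz : z ∈ Λ y → z ∉ Λ x := fun h => disjoint_left.1 hd h
      simp only [mem_inter, mem_sdiff]
      tauto
    have h := sum_indSets_le_of_conditional H (Λ x) lam hlam c (fun K S => g' K * φ S)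
      (fun K _ => g' K) ?_
    · simp only [hinv] at h
      rw [card_insert_of_notMem hx, pow_succ']
      calc _ = ∑ I ∈ indSets H univ, lam ^ I.card * (g' I * φ (I ∩ Λ x)) := by
            refine sum_congr rfl fun I _ => ?_
            rw [prod_insert hx]
            simp only [hg']
            ring
        _ ≤ _ := h
        _ ≤ c * (c ^ X.card * ∑ I ∈ indSets H univ, lam ^ I.card * g I) :=
            mul_le_mul_of_nonneg_left ih' hc
        _ = _ := by ring
    · intro K _
      have h1 := hloc x (mem_insert_self _ _) (avail H K (Λ x)) avail_subset
      have h2 : 0 ≤ g' K := mul_nonneg (hg _) (prod_nonneg fun _ _ => hφ _)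
      have h3 := mul_le_mul_of_nonneg_left h1 h2
      calc _ = g' K * ∑ S ∈ indSets H (avail H K (Λ x)), lam ^ S.card * φ S := by
            rw [mul_sum]
            exact sum_congr rfl fun S _ => by ring
        _ ≤ _ := h3
        _ = _ := by
            rw [← sum_mul]
            ring

theorem IsCover.disjoint_crossNbrs (hc : IsCover G H π) {x y : W} (h : π x = π y)
    (hne : x ≠ y) : Disjoint (crossNbrs H π x) (crossNbrs H π y) := by
  rw [disjoint_left]
  intro z hx hy
  rw [mem_crossNbrs] at hx hy
  exact hne (hc.matching z x y hx.2.symm h hx.1.symm hy.1.symm)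

theorem IsCover.adj_of_mem_crossNbrs (hc : IsCover G H π) {x y : W} (h : y ∈ crossNbrs H π x) :
    G.Adj (π x) (π y) := by
  rw [mem_crossNbrs] at h
  exact (hc.edge x y h.1).resolve_left h.2.symm

/-- The sets summed are disjoint, and an independent `I` has at most one vertex over each neighbour
of `u`. -/
theorem IsCover.sum_card_inter_crossNbrs_le [Fintype V] [DecidableRel G.Adj]
    (hc : IsCover G H π) {I : Finset W} (hI : H.IsIndepSet (I : Set W)) (u : V) :
    ∑ x ∈ fibre π u, #(I ∩ crossNbrs H π x) ≤ G.degree u := by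
  rw [← card_biUnion, ← SimpleGraph.card_neighborFinset_eq_degree]
  · refine card_le_card_of_injOn π ?_ ?_
    · intro y hy
      simp only [coe_biUnion, Set.mem_iUnion, mem_coe, mem_inter, mem_fibre] at hy
      obtain ⟨x, rfl, -, h⟩ := hy
      simpa using hc.adj_of_mem_crossNbrs h
    · intro y hy z hz h
      simp only [coe_biUnion, Set.mem_iUnion, mem_coe, mem_inter] at hy hz
      obtain ⟨_, _, hy, _⟩ := hy
      obtain ⟨_, _, hz, _⟩ := hz
      exact hc.eq_of_isIndepSet hI hy hz h
  · intro x hx y hy hne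
    rw [mem_coe, mem_fibre] at hx hy
    exact disjoint_of_subset_left inter_subset_right (disjoint_of_subset_right inter_subset_right
      (hc.disjoint_crossNbrs (hx.trans hy.symm) hne))

/-- Few colours remain available at `u`. -/
def FewAvailable (H : SimpleGraph W) (π : W → V) (ℓ : ℝ) (u : V) (I : Finset W) : Prop :=
  (#{x ∈ fibre π u | I ∩ crossNbrs H π x = ∅} : ℝ) < ℓ

/-- Some colour available at `u` has large residual degree. -/
def LargeDegree (H : SimpleGraph W) (π : W → V) (θ : ℝ) (u : V) (I : Finset W) : Prop :=
  ∃ x ∈ fibre π u, I ∩ crossNbrs H π x = ∅ ∧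
    θ < #(avail H (I \ crossNbrs H π x) (crossNbrs H π x))

/-- Exponential Markov inequality: on the event the product of tilts is at least `q`, while its mean
is at most `(1 - η / b)` to the size of the list. The weight `g` stands for conditioning on distant
events. -/
theorem IsCover.sum_fewAvailable_le [Fintype V] [DecidableRel G.Adj] (hc : IsCover G H π)
    (lam : ℝ) (hlam : 0 < lam) (D : ℕ) (hD : 1 ≤ D) (u : V) (ℓ η b c : ℝ) (hℓ : 0 < ℓ)
    (hη : 0 < η) (hη1 : η < 1) (hb : 1 ≤ b) (hc0 : 0 < c)
    (hocc : ∀ x ∈ fibre π u, ∀ T ⊆ crossNbrs H π x,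
      ∑ S ∈ indSets H T, (1 - c * S.card) * lam ^ S.card ≤ b)
    (h1 : ℓ / (1 - η) ≤ (#(fibre π u) - c * G.degree u) / b)
    (h2 : 6 * Real.log (2 * D) / η ^ 2 ≤ (#(fibre π u) - c * G.degree u) / b)
    (g : Finset W → ℝ) (hg : ∀ I, 0 ≤ g I)
    (hinv : ∀ x ∈ fibre π u, ∀ I, g (I \ crossNbrs H π x) = g I) :
    ∑ I ∈ indSets H univ, lam ^ I.card * (g I * if FewAvailable H π ℓ u I then 1 else 0) ≤
      1 / (8 * (D : ℝ) ^ 3) * ∑ I ∈ indSets H univ, lam ^ I.card * g I := by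
  set s := -c * Real.log (1 - η / b) with hs
  have hηb : η / b ≤ η := div_le_self hη.le hb
  have hηb0 : 0 < η / b := by positivity
  have hs0 : 0 ≤ s := by
    have := Real.log_nonpos (x := 1 - η / b) (by linarith) (by linarith)
    simp only [hs]
    nlinarith
  have hη' : 0 < 1 - η := by linarith
  have htilt : ∀ S : Finset W, 0 ≤ tilt η s S := fun S => by
    unfold tilt
    split_ifs <;> positivity
  have hpeel := sum_mul_prod_le H (crossNbrs H π) lam (1 - η / b) hlam (by linarith) (tilt η s)
    htilt g hg (fibre π u) hinv
    (fun x hx y hy => hc.disjoint_crossNbrs ((mem_fibre.1 hx).trans (mem_fibre.1 hy).symm))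
    (fun x hx T hT => sum_tilt_le T lam b c η hlam hc0 hη hη1 hb
      fun A hA => hocc x hx A (hA.trans hT))
  set q := (1 - η) ^ ℓ * Real.exp (-s * G.degree u) with hq
  have hq0 : 0 < q := by positivity
  have hprod : ∀ I ∈ indSets H univ, q * (if FewAvailable H π ℓ u I then 1 else 0) ≤
      ∏ x ∈ fibre π u, tilt η s (I ∩ crossNbrs H π x) := by
    intro I hI
    split_ifs with hB
    · rw [mul_one]
      unfold tilt
      rw [prod_mul_distrib, prod_ite, prod_const, prod_const_one, mul_one, ← Real.exp_sum,
        ← mul_sum]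
      refine mul_le_mul ?_ ?_ (by positivity) (by positivity)
      · rw [← Real.rpow_natCast]
        exact Real.rpow_le_rpow_of_exponent_ge hη' (by linarith) hB.le
      · rw [Real.exp_le_exp]
        have := hc.sum_card_inter_crossNbrs_le (mem_indSets.1 hI).2 u
        have : ∑ x ∈ fibre π u, (#(I ∩ crossNbrs H π x) : ℝ) ≤ G.degree u := by
          exact_mod_cast this
        nlinarith
    · rw [mul_zero]
      exact prod_nonneg fun _ _ => htilt _
  have htail := tail_bound #(fibre π u) D (G.degree u) ℓ η b c hD hℓ hη hη1 hb h1 h2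
  have hG : 0 ≤ ∑ I ∈ indSets H univ, lam ^ I.card * g I :=
    sum_nonneg fun I _ => mul_nonneg (by positivity) (hg I)
  refine le_of_mul_le_mul_left ?_ hq0
  calc _ = ∑ I ∈ indSets H univ, lam ^ I.card *
        (g I * (q * if FewAvailable H π ℓ u I then 1 else 0)) := by
        rw [mul_sum]
        exact sum_congr rfl fun I _ => by ring
    _ ≤ ∑ I ∈ indSets H univ, lam ^ I.card *
        (g I * ∏ x ∈ fibre π u, tilt η s (I ∩ crossNbrs H π x)) := by
        refine sum_le_sum fun I hI => ?_
        exact mul_le_mul_of_nonneg_left (mul_le_mul_of_nonneg_left (hprod I hI) (hg I))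
          (by positivity)
    _ ≤ _ := hpeel
    _ ≤ _ := mul_le_mul_of_nonneg_right htail hG
    _ = _ := by ring

/-- Given `I` outside `crossNbrs H π x`, the free part `T` is fixed and is missed by `I` with
probability `1 / Z_T`; sum over the colours `x`. -/
theorem sum_largeDegree_le (H : SimpleGraph W) (π : W → V) (lam : ℝ) (hlam : 0 < lam) (D : ℕ)
    (hD : 1 ≤ D) (u : V) (θ : ℝ)
    (hZ : ∀ x ∈ fibre π u, ∀ T ⊆ crossNbrs H π x, θ < #T →
      8 * (#(fibre π u) : ℝ) * (D : ℝ) ^ 3 ≤ ∑ S ∈ indSets H T, lam ^ S.card)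
    (g : Finset W → ℝ) (hg : ∀ I, 0 ≤ g I)
    (hinv : ∀ x ∈ fibre π u, ∀ I, g (I \ crossNbrs H π x) = g I) :
    ∑ I ∈ indSets H univ, lam ^ I.card * (g I * if LargeDegree H π θ u I then 1 else 0) ≤
      1 / (8 * (D : ℝ) ^ 3) * ∑ I ∈ indSets H univ, lam ^ I.card * g I := by
  have hD0 : (0 : ℝ) < D := by exact_mod_cast hD
  have hG : 0 ≤ ∑ I ∈ indSets H univ, lam ^ I.card * g I :=
    sum_nonneg fun I _ => mul_nonneg (by positivity) (hg I)
  have hx : ∀ x ∈ fibre π u, ∑ I ∈ indSets H univ, lam ^ I.card * (g (I \ crossNbrs H π x) *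
      if I ∩ crossNbrs H π x = ∅ ∧ θ < #(avail H (I \ crossNbrs H π x) (crossNbrs H π x))
        then 1 else 0) ≤ 1 / (8 * (#(fibre π u) : ℝ) * (D : ℝ) ^ 3) *
        ∑ I ∈ indSets H univ, lam ^ I.card * g (I \ crossNbrs H π x) := by
    intro x hx
    have hL : (0 : ℝ) < #(fibre π u) := by exact_mod_cast card_pos.2 ⟨x, hx⟩
    refine sum_indSets_le_of_conditional H (crossNbrs H π x) lam hlam _
      (fun K S => g K * if S = ∅ ∧ θ < #(avail H K (crossNbrs H π x)) then 1 else 0)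
      (fun K _ => g K) fun K _ => ?_
    set T := avail H K (crossNbrs H π x) with hT
    rw [← sum_mul]
    by_cases hθ : θ < #T
    · have hz := hZ x hx T avail_subset hθ
      have : ∑ S ∈ indSets H T, lam ^ #S * (g K * if S = ∅ ∧ θ < #T then 1 else 0) = g K := by
        rw [sum_eq_single_of_mem ∅ (empty_mem_indSets H T)]
        · simp [hθ]
        · intro S _ hS
          simp [hS]
      rw [this, ← mul_assoc]
      refine le_mul_of_one_le_left (hg K) ?_
      rw [one_div, inv_mul_eq_div, one_le_div (by positivity)]
      exact hz
    · simp only [hθ, and_false, if_false, mul_zero, sum_const_zero]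
      have := hg K
      positivity
  calc _ ≤ ∑ I ∈ indSets H univ, ∑ x ∈ fibre π u, lam ^ I.card * (g (I \ crossNbrs H π x) *
      if I ∩ crossNbrs H π x = ∅ ∧ θ < #(avail H (I \ crossNbrs H π x) (crossNbrs H π x))
        then 1 else 0) := by
        refine sum_le_sum fun I _ => ?_
        have hterm : ∀ x ∈ fibre π u, 0 ≤ lam ^ I.card * (g (I \ crossNbrs H π x) *
            if I ∩ crossNbrs H π x = ∅ ∧ θ < #(avail H (I \ crossNbrs H π x) (crossNbrs H π x))
            then (1 : ℝ) else 0) := by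
          intro x _
          have := hg (I \ crossNbrs H π x)
          split_ifs <;> positivity
        split_ifs with hB
        · obtain ⟨x, hx, h⟩ := hB
          refine le_trans ?_ (single_le_sum hterm hx)
          rw [if_pos h, hinv x hx]
        · rw [mul_zero, mul_zero]
          exact sum_nonneg hterm
    _ = ∑ x ∈ fibre π u, ∑ I ∈ indSets H univ, lam ^ I.card * (g (I \ crossNbrs H π x) *
      if I ∩ crossNbrs H π x = ∅ ∧ θ < #(avail H (I \ crossNbrs H π x) (crossNbrs H π x))
        then 1 else 0) := sum_comm
    _ ≤ ∑ x ∈ fibre π u, 1 / (8 * (#(fibre π u) : ℝ) * (D : ℝ) ^ 3) *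
        ∑ I ∈ indSets H univ, lam ^ I.card * g I := by
        refine sum_le_sum fun x h => (hx x h).trans (le_of_eq ?_)
        simp only [hinv x h]
    _ ≤ _ := by
        rw [sum_const, nsmul_eq_mul, ← mul_assoc]
        refine mul_le_mul_of_nonneg_right ?_ hG
        rcases Nat.eq_zero_or_pos #(fibre π u) with h0 | h0
        · rw [h0]
          simp only [CharP.cast_eq_zero, zero_mul]
          positivity
        · have : (0 : ℝ) < #(fibre π u) := by exact_mod_cast h0
          apply le_of_eq
          field_simp

end

/-! ### Extension of a good partial colouring, dependencies, and use of the local lemma. -/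

section

variable {V W : Type*} [Fintype W] {G : SimpleGraph V} {H : SimpleGraph W} {π : W → V}

/-- A partial colouring after which all lists are large and all residual degrees small can be
extended. -/
theorem IsCover.exists_extension (hc : IsCover G H π) (U : Finset V) (ℓ θ : V → ℝ)
    (hℓ : ∀ u ∈ U, 0 < ℓ u) (hθ : ∀ u ∈ U, ∀ v ∈ U, G.Adj u v → 8 * θ u ≤ ℓ v)
    (I : Finset W) (hI : H.IsIndepSet (I : Set W))
    (h1 : ∀ u ∈ U, ¬ FewAvailable H π (ℓ u) u I) (h2 : ∀ u ∈ U, ¬ LargeDegree H π (θ u) u I) :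
    ∃ J : Finset W, H.IsIndepSet (J : Set W) ∧ ∀ u ∈ U, ∃ x ∈ J, π x = u := by
  set U' : Finset V := {u ∈ U | ∀ x ∈ I, π x ≠ u} with hU'
  set A : Finset W := {x | π x ∈ U' ∧ I ∩ crossNbrs H π x = ∅} with hA
  have memA : ∀ x, x ∈ A ↔ π x ∈ U' ∧ I ∩ crossNbrs H π x = ∅ := by simp [hA]
  have memU' : ∀ u, u ∈ U' ↔ u ∈ U ∧ ∀ x ∈ I, π x ≠ u := by simp [hU']
  have hfree : ∀ x ∈ A, ∀ t ∈ I, ¬ H.Adj x t := by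
    intro x hx t ht hadj
    obtain ⟨hxU, hx⟩ := (memA x).1 hx
    have : t ∈ I ∩ crossNbrs H π x :=
      mem_inter.2 ⟨ht, mem_crossNbrs.2 ⟨hadj, ((memU' _).1 hxU).2 t ht⟩⟩
    rw [hx] at this
    exact notMem_empty t this
  have htrans := hc.exists_transversal A U' ℓ
    (fun u hu => hℓ u ((memU' u).1 hu).1) (fun x hx => ((memA x).1 hx).1) ?_ ?_
  · obtain ⟨R, hRA, hRind, hRU⟩ := htrans
    refine ⟨R ∪ I, isIndepSet_union hRind hI fun y hy z hz => hfree y (hRA hy) z hz, ?_⟩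
    intro u hu
    by_cases h : ∀ x ∈ I, π x ≠ u
    · have : u ∈ R.image π := hRU ▸ (memU' u).2 ⟨hu, h⟩
      obtain ⟨x, hx, rfl⟩ := mem_image.1 this
      exact ⟨x, mem_union_left _ hx, rfl⟩
    · push Not at h
      obtain ⟨x, hx, rfl⟩ := h
      exact ⟨x, mem_union_right _ hx, rfl⟩
  · intro u hu
    have := not_lt.1 (h1 u ((memU' u).1 hu).1)
    refine this.trans (le_of_eq ?_)
    congr 2
    ext x
    simp only [mem_filter, mem_inter, mem_fibre, memA]
    exact ⟨fun h => ⟨⟨h.1 ▸ hu, h.2⟩, h.1⟩, fun h => ⟨h.2, h.1.2⟩⟩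
  · intro x hx y hy
    obtain ⟨hxU, hxI⟩ := (memA x).1 hx
    have hxU := (memU' _).1 hxU
    obtain ⟨hyA, hxy⟩ := mem_inter.1 hy
    have hyU := (memU' _).1 ((memA y).1 hyA).1
    have hle : (#(A ∩ crossNbrs H π x) : ℝ) ≤ θ (π x) := by
      have := h2 _ hxU.1
      simp only [LargeDegree, not_exists, not_and, not_lt] at this
      refine le_trans ?_ (this x (mem_fibre.2 rfl) hxI)
      refine Nat.cast_le.2 (card_le_card fun z hz => ?_)
      rw [mem_inter] at hz
      exact mem_avail.2 ⟨hz.2, fun t ht => hfree z hz.1 t (mem_sdiff.1 ht).1⟩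
    have := hθ _ hxU.1 _ hyU.1 (hc.adj_of_mem_crossNbrs hxy)
    linarith

variable [Fintype V]

/-- The vertices whose bad event may depend on the colours around `u`. -/
noncomputable def dependent (G : SimpleGraph V) (u : V) : Finset V :=
  {v | v ≠ u ∧ ∃ w, G.Adj u w ∧ (G.Adj v w ∨ ∃ z, G.Adj v z ∧ G.Adj z w)}

/-- The bad event at `v` reads `I` only over vertices reached from `v` by walks of length one or
two, and no neighbour of `u` is such a vertex. -/
theorem IsCover.bad_sdiff_iff (hc : IsCover G H π) (ℓ θ : ℝ) {u v : V} (hne : v ≠ u)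
    (hv : v ∉ dependent G u) {x : W} (hx : x ∈ fibre π u) (I : Finset W) :
    (FewAvailable H π ℓ v (I \ crossNbrs H π x) ∨ LargeDegree H π θ v (I \ crossNbrs H π x)) ↔
      (FewAvailable H π ℓ v I ∨ LargeDegree H π θ v I) := by
  have hno : ∀ w, G.Adj u w → ¬ G.Adj v w ∧ ∀ z, G.Adj v z → ¬ G.Adj z w := by
    intro w huw
    by_contra h
    refine hv ?_
    simp only [dependent, mem_filter, mem_univ, true_and]
    refine ⟨hne, w, huw, ?_⟩
    by_contra h'
    push Not at h'
    exact h h'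
  have hux : ∀ t ∈ crossNbrs H π x, G.Adj u (π t) := fun t ht =>
    mem_fibre.1 hx ▸ hc.adj_of_mem_crossNbrs ht
  have hcap : ∀ y ∈ fibre π v, (I \ crossNbrs H π x) ∩ crossNbrs H π y =
      I ∩ crossNbrs H π y := by
    intro y hy
    ext t
    simp only [mem_inter, mem_sdiff]
    refine ⟨fun h => ⟨h.1.1, h.2⟩, fun h => ⟨⟨h.1, fun ht => ?_⟩, h.2⟩⟩
    exact (hno _ (hux t ht)).1 (mem_fibre.1 hy ▸ hc.adj_of_mem_crossNbrs h.2)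
  have havail : ∀ y ∈ fibre π v,
      avail H ((I \ crossNbrs H π x) \ crossNbrs H π y) (crossNbrs H π y) =
      avail H (I \ crossNbrs H π y) (crossNbrs H π y) := by
    intro y hy
    ext z
    simp only [mem_avail]
    refine and_congr_right fun hz => ⟨fun h t ht hadj => ?_, fun h t ht => ?_⟩
    · have hvz : G.Adj v (π z) := mem_fibre.1 hy ▸ hc.adj_of_mem_crossNbrs hz
      rw [mem_sdiff] at ht
      by_cases htx : t ∈ crossNbrs H π x
      · have h3 := hno _ (hux t htx)
        rcases hc.edge z t hadj with h | h
        · exact h3.1 (h ▸ hvz)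
        · exact h3.2 _ hvz h
      · exact h t (by simp [ht.1, ht.2, htx]) hadj
    · simp only [mem_sdiff] at ht
      exact h t (mem_sdiff.2 ⟨ht.1.1, ht.2⟩)
  refine or_congr ?_ ?_
  · unfold FewAvailable
    rw [filter_congr fun y hy => by rw [hcap y hy]]
  · unfold LargeDegree
    refine exists_congr fun y => and_congr_right fun hy => ?_
    rw [hcap y hy, havail y hy]

variable [DecidableRel G.Adj]

/-- Non-backtracking walks through each neighbour `w` of `u` give at most `1 + (D - 1) + (D - 1) ^ 2
≤ D ^ 2` vertices, where the 1 accounts for `w` itself. -/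
theorem card_dependent_le {V : Type*} [Fintype V] {G : SimpleGraph V} [DecidableRel G.Adj] (D : ℕ) (hD : ∀ u, G.degree u ≤ D) (u : V) :
    #(dependent G u) ≤ D ^ 3 := by
  have hsub : dependent G u ⊆ (G.neighborFinset u).biUnion fun w =>
      {w} ∪ ((G.neighborFinset w).erase u ∪
        ((G.neighborFinset w).erase u).biUnion fun z => (G.neighborFinset z).erase w) := by
    intro v hv
    simp only [dependent, mem_filter, mem_univ, true_and] at hv
    obtain ⟨hvu, w, huw, h⟩ := hv
    simp only [mem_biUnion, mem_union, mem_singleton, mem_erase, SimpleGraph.mem_neighborFinset]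
    rcases h with h | ⟨z, hvz, hzw⟩
    · exact ⟨w, huw, Or.inr (Or.inl ⟨hvu, h.symm⟩)⟩
    · by_cases hzu : z = u
      · subst hzu
        exact ⟨v, hvz.symm, Or.inl rfl⟩
      · by_cases hvw : v = w
        · exact ⟨w, huw, Or.inl hvw⟩
        · exact ⟨w, huw, Or.inr (Or.inr ⟨z, ⟨hzu, hzw.symm⟩, hvw, hvz.symm⟩)⟩
  have herase : ∀ a b, G.Adj a b → #((G.neighborFinset a).erase b) ≤ D - 1 := by
    intro a b h
    rw [card_erase_of_mem (by simpa using h), SimpleGraph.card_neighborFinset_eq_degree]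
    exact Nat.sub_le_sub_right (hD a) 1
  refine (card_le_card hsub).trans ?_
  have hw : ∀ w ∈ G.neighborFinset u, #({w} ∪ ((G.neighborFinset w).erase u ∪
      ((G.neighborFinset w).erase u).biUnion fun z => (G.neighborFinset z).erase w)) ≤ D ^ 2 := by
    intro w hw
    rw [SimpleGraph.mem_neighborFinset] at hw
    have h1 := herase w u hw.symm
    have h2 : #(((G.neighborFinset w).erase u).biUnion fun z => (G.neighborFinset z).erase w) ≤
        (D - 1) * (D - 1) := by
      refine (card_biUnion_le_card_mul _ _ (D - 1) fun z hz => ?_).trans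
        (Nat.mul_le_mul_right _ h1)
      rw [mem_erase, SimpleGraph.mem_neighborFinset] at hz
      exact herase z w hz.2.symm
    have h3 : 1 ≤ D := by
      refine le_trans ?_ (hD u)
      rw [← SimpleGraph.card_neighborFinset_eq_degree]
      exact card_pos.2 ⟨w, by simpa using hw⟩
    refine (card_union_le _ _).trans ?_
    refine (Nat.add_le_add_left ((card_union_le _ _).trans (Nat.add_le_add h1 h2)) _).trans ?_
    rw [card_singleton]
    obtain ⟨k, rfl⟩ := Nat.exists_eq_add_of_le h3
    simp only [Nat.add_sub_cancel_left]
    nlinarith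
  refine (card_biUnion_le_card_mul _ _ _ hw).trans ?_
  rw [SimpleGraph.card_neighborFinset_eq_degree, pow_succ' D 2]
  exact Nat.mul_le_mul_right _ (hD u)

/-- Local occupancy yields an independent set of the cover that meets all lists over `U`. -/
theorem IsCover.exists_indepSet_of_occupancy (hc : IsCover G H π) (lam : ℝ) (hlam : 0 < lam)
    (U : Finset V) (D : ℕ) (hD : 1 ≤ D) (hdeg : ∀ u, G.degree u ≤ D) (ℓ η b c θ : V → ℝ)
    (hℓ : ∀ u ∈ U, 0 < ℓ u) (hη : ∀ u ∈ U, 0 < η u) (hη1 : ∀ u ∈ U, η u < 1)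
    (hb : ∀ u ∈ U, 1 ≤ b u) (hc0 : ∀ u ∈ U, 0 < c u)
    (hocc : ∀ u ∈ U, ∀ x ∈ fibre π u, ∀ T ⊆ crossNbrs H π x,
      ∑ S ∈ indSets H T, (1 - c u * S.card) * lam ^ S.card ≤ b u)
    (h1 : ∀ u ∈ U, ℓ u / (1 - η u) ≤ (#(fibre π u) - c u * G.degree u) / b u)
    (h2 : ∀ u ∈ U, 6 * Real.log (2 * D) / η u ^ 2 ≤ (#(fibre π u) - c u * G.degree u) / b u)
    (hθ : ∀ u ∈ U, ∀ v ∈ U, G.Adj u v → 8 * θ u ≤ ℓ v)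
    (hZ : ∀ u ∈ U, ∀ x ∈ fibre π u, ∀ T ⊆ crossNbrs H π x, θ u < #T →
      8 * (#(fibre π u) : ℝ) * (D : ℝ) ^ 3 ≤ ∑ S ∈ indSets H T, lam ^ S.card) :
    ∃ J : Finset W, H.IsIndepSet (J : Set W) ∧ ∀ u ∈ U, ∃ x ∈ J, π x = u := by
  have hD1 : (1 : ℝ) ≤ D := by exact_mod_cast hD
  have hD3 : (1 : ℝ) ≤ (D : ℝ) ^ 3 := one_le_pow₀ hD1
  have hlll := lopsided_local_lemma (indSets H univ) (fun I => lam ^ I.card)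
    (fun I _ => by positivity)
    (sum_pos (fun I _ => by positivity) ⟨∅, empty_mem_indSets H _⟩) U
    (fun u I => FewAvailable H π (ℓ u) u I ∨ LargeDegree H π (θ u) u I) (dependent G)
    -- Two bad events of weight `1 / (8 * D ^ 3)` each, against at most `D ^ 3` dependencies.
    (1 / (4 * (D : ℝ) ^ 3)) (by positivity)
    (by rw [div_le_div_iff₀ (by positivity) (by norm_num)]; linarith) ?_ ?_
  · obtain ⟨I, hI, hgood⟩ := hlll
    exact hc.exists_extension U ℓ θ hℓ hθ I (mem_indSets.1 hI).2
      (fun u hu h => hgood u hu (Or.inl h)) (fun u hu h => hgood u hu (Or.inr h))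
  · intro u _
    have : (#(dependent G u) : ℝ) ≤ (D : ℝ) ^ 3 := by
      exact_mod_cast card_dependent_le D hdeg u
    rw [mul_one_div, div_le_div_iff₀ (by positivity) (by norm_num)]
    linarith
  · intro u hu S hS huS hdisj
    set g : Finset W → ℝ := fun I =>
      if ∀ v ∈ S, ¬ (FewAvailable H π (ℓ v) v I ∨ LargeDegree H π (θ v) v I) then 1 else 0 with hg
    have hg0 : ∀ I, 0 ≤ g I := fun I => by simp only [hg]; split_ifs <;> norm_num
    have hinv : ∀ x ∈ fibre π u, ∀ I, g (I \ crossNbrs H π x) = g I := by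
      intro x hx I
      have : (∀ v ∈ S, ¬ (FewAvailable H π (ℓ v) v (I \ crossNbrs H π x) ∨
          LargeDegree H π (θ v) v (I \ crossNbrs H π x))) ↔
          ∀ v ∈ S, ¬ (FewAvailable H π (ℓ v) v I ∨ LargeDegree H π (θ v) v I) := by
        refine forall₂_congr fun v hv => not_congr ?_
        exact hc.bad_sdiff_iff _ _ (ne_of_mem_of_not_mem hv huS) (disjoint_left.1 hdisj hv) hx I
      simp only [hg, this]
    have e1 := hc.sum_fewAvailable_le lam hlam D hD u (ℓ u) (η u) (b u) (c u) (hℓ u hu) (hη u hu)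
      (hη1 u hu) (hb u hu) (hc0 u hu) (hocc u hu) (h1 u hu) (h2 u hu) g hg0 hinv
    have e2 := sum_largeDegree_le H π lam hlam D hD u (θ u) (hZ u hu) g hg0 hinv
    have e3 : ∑ I ∈ indSets H univ with
        ∀ v ∈ S, ¬ (FewAvailable H π (ℓ v) v I ∨ LargeDegree H π (θ v) v I), lam ^ I.card =
        ∑ I ∈ indSets H univ, lam ^ I.card * g I := by
      rw [sum_filter]
      exact sum_congr rfl fun I _ => by simp only [hg, mul_ite, mul_one, mul_zero]
    suffices h : ∑ I ∈ indSets H univ with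
        (∀ v ∈ S, ¬ (FewAvailable H π (ℓ v) v I ∨ LargeDegree H π (θ v) v I)) ∧
          (FewAvailable H π (ℓ u) u I ∨ LargeDegree H π (θ u) u I), lam ^ I.card ≤
        1 / (4 * (D : ℝ) ^ 3) * ∑ I ∈ indSets H univ, lam ^ I.card * g I by
      rw [← e3] at h
      convert h
    calc _ ≤ ∑ I ∈ indSets H univ,
          lam ^ I.card * (g I * if FewAvailable H π (ℓ u) u I then 1 else 0) +
          ∑ I ∈ indSets H univ,
          lam ^ I.card * (g I * if LargeDegree H π (θ u) u I then 1 else 0) := by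
          rw [← sum_add_distrib, sum_filter]
          refine sum_le_sum fun I _ => ?_
          have hp : 0 ≤ lam ^ I.card := by positivity
          by_cases hS : ∀ v ∈ S, ¬ (FewAvailable H π (ℓ v) v I ∨ LargeDegree H π (θ v) v I)
          · have hgI : g I = 1 := if_pos hS
            rw [hgI, if_congr (and_iff_right hS) rfl rfl]
            by_cases hF : FewAvailable H π (ℓ u) u I <;>
              by_cases hL : LargeDegree H π (θ u) u I <;> simp [hF, hL, hp]
          · have hgI : g I = 0 := if_neg hS
            rw [hgI, if_neg fun h => hS h.1]
            simp
      _ ≤ _ := add_le_add e1 e2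
      _ = _ := by
          field_simp
          ring

end

/-! ### Transfer of occupancy and partition functions between `G` and the cover. -/

section

variable {V W : Type*} [Fintype V] {G : SimpleGraph V}

theorem mem_indepSets {F : G.Subgraph} {I : Finset V} :
    I ∈ indepSets F ↔ (∀ x ∈ I, x ∈ F.verts) ∧ ∀ x ∈ I, ∀ y ∈ I, ¬ F.Adj x y := by
  simp [indepSets]

theorem eval_Z (F : G.Subgraph) (lam : ℝ) :
    (Z F).eval lam = ∑ I ∈ indepSets F, lam ^ I.card := by
  simp [Z, eval_finsetSum]

theorem mul_eval_derivative_Z (F : G.Subgraph) (lam : ℝ) :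
    lam * (derivative (Z F)).eval lam = ∑ I ∈ indepSets F, (I.card : ℝ) * lam ^ I.card := by
  simp only [Z, derivative_sum, eval_finsetSum, mul_sum]
  refine sum_congr rfl fun I _ => ?_
  rcases Nat.eq_zero_or_pos I.card with h | h
  · simp [h]
  · obtain ⟨k, hk⟩ := Nat.exists_eq_add_of_lt h
    rw [hk]
    simp
    ring

theorem empty_mem_indepSets (F : G.Subgraph) : ∅ ∈ indepSets F := by simp [mem_indepSets]

theorem eval_Z_pos (F : G.Subgraph) {lam : ℝ} (hlam : 0 < lam) : 0 < (Z F).eval lam := by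
  rw [eval_Z]
  exact sum_pos (fun I _ => by positivity) ⟨∅, empty_mem_indepSets F⟩

theorem sum_le_of_occupancyBound {lam β γ : ℝ} {F : G.Subgraph} (hlam : 0 < lam)
    (h : OccupancyBound lam β γ F) :
    ∑ I ∈ indepSets F, (1 - γ * I.card) * lam ^ I.card ≤ β * (lam / (1 + lam)) := by
  have hZ := eval_Z_pos F hlam
  unfold OccupancyBound at h
  rw [mul_eval_derivative_Z] at h
  have h2 := mul_le_mul_of_nonneg_right h hZ.le
  rw [one_mul, add_mul, mul_assoc, one_div_mul_cancel hZ.ne', mul_one, mul_assoc,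
    div_mul_cancel₀ _ hZ.ne', eval_Z] at h2
  have e : ∑ I ∈ indepSets F, (1 - γ * I.card) * lam ^ I.card =
      ∑ I ∈ indepSets F, lam ^ I.card - γ * ∑ I ∈ indepSets F, (I.card : ℝ) * lam ^ I.card := by
    rw [mul_sum, ← sum_sub_distrib]
    exact sum_congr rfl fun I _ => by ring
  linarith

/-- The null graph has constant `Z = 1`. The bound keeps `η / b ≤ η < 1` in the tilting. -/
theorem one_le_of_occupancyBound_bot {lam β γ : ℝ} (hlam : 0 < lam)
    (h : OccupancyBound lam β γ (⊥ : G.Subgraph)) : 1 ≤ β * (lam / (1 + lam)) := by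
  have e : indepSets (⊥ : G.Subgraph) = {∅} := by
    ext I
    simp [mem_indepSets, eq_empty_iff_forall_notMem]
  have := sum_le_of_occupancyBound hlam h
  simpa [e] using this

/-- The projection to `G` of the subgraph of the cover induced by `T`. -/
def imageSubgraph {H : SimpleGraph W} {π : W → V} (hc : IsCover G H π) (T : Finset W) :
    G.Subgraph where
  verts := π '' T
  Adj v w := v ≠ w ∧ ∃ y ∈ T, ∃ z ∈ T, π y = v ∧ π z = w ∧ H.Adj y z
  adj_sub := by
    rintro _ _ ⟨hne, y, -, z, -, rfl, rfl, h⟩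
    exact (hc.edge y z h).resolve_left hne
  edge_vert := by
    rintro _ _ ⟨-, y, hy, -, -, rfl, -, -⟩
    exact ⟨y, hy, rfl⟩
  symm := by
    refine ⟨?_⟩
    rintro _ _ ⟨hne, y, hy, z, hz, rfl, rfl, h⟩
    exact ⟨hne.symm, z, hz, y, hy, rfl, rfl, h.symm⟩

variable [Fintype W] {H : SimpleGraph W} {π : W → V}

omit [Fintype V] in
theorem IsCover.injOn_crossNbrs (hc : IsCover G H π) {x : W} {T : Finset W}
    (hT : T ⊆ crossNbrs H π x) : Set.InjOn π T := by
  intro y hy z hz h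
  have hy := mem_crossNbrs.1 (hT hy)
  have hz := mem_crossNbrs.1 (hT hz)
  exact hc.matching x y z hy.2 h hy.1 hz.1

/-- By the matching condition `π` is injective on `T`, so it identifies `H[T]` with its image. -/
theorem IsCover.sum_indepSets_imageSubgraph (hc : IsCover G H π) {x : W} {T : Finset W}
    (hT : T ⊆ crossNbrs H π x) (f : ℕ → ℝ) :
    ∑ I ∈ indepSets (imageSubgraph hc T), f I.card = ∑ S ∈ indSets H T, f S.card := by
  have hinj := hc.injOn_crossNbrs hT
  symm
  refine sum_bij' (fun S _ => S.image π) (fun I _ => {y ∈ T | π y ∈ I}) ?_ ?_ ?_ ?_ ?_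
  · intro S hS
    obtain ⟨hST, hS⟩ := mem_indSets.1 hS
    rw [mem_indepSets]
    refine ⟨fun v hv => ?_, fun v hv w hw hadj => ?_⟩
    · obtain ⟨y, hy, rfl⟩ := mem_image.1 hv
      exact ⟨y, hST hy, rfl⟩
    · obtain ⟨y, hy, rfl⟩ := mem_image.1 hv
      obtain ⟨z, hz, rfl⟩ := mem_image.1 hw
      obtain ⟨-, y', hy', z', hz', e1, e2, h⟩ := hadj
      rw [hinj hy' (hST hy) e1, hinj hz' (hST hz) e2] at h
      exact hS hy hz h.ne h
  · intro I hI
    rw [mem_indepSets] at hI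
    refine mem_indSets.2 ⟨filter_subset _ _, fun y hy z hz hne hadj => ?_⟩
    rw [mem_coe, mem_filter] at hy hz
    exact hI.2 _ hy.2 _ hz.2
      ⟨fun h => hne (hinj hy.1 hz.1 h), y, hy.1, z, hz.1, rfl, rfl, hadj⟩
  · intro S hS
    obtain ⟨hST, -⟩ := mem_indSets.1 hS
    ext y
    simp only [mem_filter, mem_image]
    constructor
    · rintro ⟨hy, z, hz, h⟩
      exact hinj (hST hz) hy h ▸ hz
    · exact fun hy => ⟨hST hy, y, hy, rfl⟩
  · intro I hI
    rw [mem_indepSets] at hI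
    ext v
    simp only [mem_filter, mem_image]
    constructor
    · rintro ⟨y, hy, rfl⟩
      exact hy.2
    · intro hv
      obtain ⟨y, hy, rfl⟩ := hI.1 v hv
      exact ⟨y, ⟨hy, hv⟩, rfl⟩
  · intro S hS
    obtain ⟨hST, -⟩ := mem_indSets.1 hS
    rw [card_image_of_injOn (hinj.mono (by exact_mod_cast hST))]

omit [Fintype V] in
theorem IsCover.imageSubgraph_verts_subset (hc : IsCover G H π) {x : W} {T : Finset W}
    (hT : T ⊆ crossNbrs H π x) : (imageSubgraph hc T).verts ⊆ G.neighborSet (π x) := by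
  rintro _ ⟨y, hy, rfl⟩
  exact hc.adj_of_mem_crossNbrs (hT hy)

/-- A lower bound for `Z` on large induced subgraphs of a neighbourhood passes to the cover. -/
theorem IsCover.le_sum_indSets (hc : IsCover G H π) {lam : ℝ} (hlam : 0 < lam) {x : W}
    {T : Finset W} (hT : T ⊆ crossNbrs H π x) (P : ℝ → Prop) (M : ℝ) (hP : P #T)
    (h : ∀ F : G.Subgraph, F.verts ⊆ G.neighborSet (π x) → F.IsInduced → P F.verts.ncard →
      M ≤ (Z F).eval lam) : M ≤ ∑ S ∈ indSets H T, lam ^ S.card := by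
  rw [← hc.sum_indepSets_imageSubgraph hT (fun n => lam ^ n)]
  have hF := h ((⊤ : G.Subgraph).induce (π '' T)) (hc.imageSubgraph_verts_subset hT) ?_ ?_
  · refine hF.trans ?_
    rw [eval_Z]
    -- The image of `H[T]` may have fewer edges than the induced subgraph on the same vertices,
    -- which only adds independent sets.
    refine sum_le_sum_of_subset_of_nonneg ?_ fun I _ _ => by positivity
    intro I hI
    rw [mem_indepSets] at hI ⊢
    refine ⟨hI.1, fun v hv w hw hadj => hI.2 v hv w hw ?_⟩
    exact ⟨hI.1 v hv, hI.1 w hw, (imageSubgraph hc T).adj_sub hadj⟩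
  · intro v hv w hw hadj
    exact ⟨hv, hw, hadj⟩
  · have : (π '' (T : Set W)).ncard = #T := by
      rw [Set.InjOn.ncard_image (hc.injOn_crossNbrs hT), Set.ncard_coe_finset]
    change P ((π '' (T : Set W)).ncard : ℝ)
    rwa [this]

theorem ellStar_le (l : V → ℝ) {u v : V} (h : G.Adj u v) : ellStar G l u ≤ l v / 8 :=
  csInf_le (Set.toFinite _).bddBelow ⟨v, h, rfl⟩

variable [DecidableRel G.Adj]

/-! ### The two choices of parameters, and the final theorem. -/

/-- Uniform parameters. -/
theorem IsCover.exists_full_of_uniform (hc : IsCover G H π) (lam : ℝ) (hlam : 0 < lam)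
    (b c : V → ℝ) (hb : ∀ u, 1 ≤ b u) (hc0 : ∀ u, 0 < c u)
    (hocc : ∀ x, ∀ T ⊆ crossNbrs H π x,
      ∑ S ∈ indSets H T, (1 - c (π x) * S.card) * lam ^ S.card ≤ b (π x))
    (ℓ : ℝ) (hΔ : 2 ^ 6 ≤ G.maxDegree) (hℓ : 7 * Real.log G.maxDegree < ℓ)
    (hL : ∀ u, b u * (ℓ / (1 - Real.sqrt (7 * Real.log G.maxDegree / ℓ))) + c u * G.degree u ≤
      #(fibre π u))
    (hZ : ∀ u : V, ∀ F : G.Subgraph, F.verts ⊆ G.neighborSet u → F.IsInduced →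
        ℓ / 8 ≤ F.verts.ncard → 8 * (G.maxDegree : ℝ) ^ 4 ≤ (Z F).eval lam) :
    ∃ J : Finset W, H.IsIndepSet (J : Set W) ∧ #J = Fintype.card V := by
  set D := G.maxDegree with hD
  have hD64 : (64 : ℝ) ≤ D := by
    exact_mod_cast hΔ
  have hlog : 0 < Real.log D := Real.log_pos (by linarith)
  have hℓ0 : 0 < ℓ := by linarith
  set η := Real.sqrt (7 * Real.log D / ℓ) with hη
  have hη0 : 0 < η := Real.sqrt_pos.2 (by positivity)
  have hη1 : η < 1 := by
    rw [hη, Real.sqrt_lt' one_pos, one_pow, div_lt_one hℓ0]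
    exact hℓ
  have hηsq : η ^ 2 = 7 * Real.log D / ℓ := Real.sq_sqrt (by positivity)
  have hμ : ∀ u, ℓ / (1 - η) ≤ (#(fibre π u) - c u * G.degree u) / b u := by
    intro u
    have := hL u
    rw [le_div_iff₀ (by linarith [hb u])]
    linarith
  -- Here `D ≥ 2 ^ 6` turns `6 * log (2 * D)` into `7 * log D`.
  have hlog2 : 6 * Real.log (2 * D) ≤ 7 * Real.log D := by
    have h64 : 6 * Real.log 2 ≤ Real.log D := by
      have : Real.log ((2 : ℝ) ^ 6) ≤ Real.log D :=
        Real.log_le_log (by norm_num) (le_of_eq_of_le (by norm_num) hD64)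
      rw [Real.log_pow] at this
      exact_mod_cast this
    rw [Real.log_mul (by norm_num) (by linarith)]
    linarith
  -- Only lists of size at most `D` are treated, so that `8 * D ^ 4` dominates `8 * #(fibre π u) * D
  -- ^ 3`; longer lists are left to the greedy step.
  obtain ⟨I, hI, hcov⟩ := hc.exists_indepSet_of_occupancy lam hlam {u | #(fibre π u) ≤ D} D
    (by omega) G.degree_le_maxDegree (fun _ => ℓ) (fun _ => η) b c (fun _ => ℓ / 8)
    (fun _ _ => hℓ0) (fun _ _ => hη0) (fun _ _ => hη1) (fun u _ => hb u) (fun u _ => hc0 u)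
    (fun u _ x hx T hT => mem_fibre.1 hx ▸ hocc x T hT) (fun u _ => hμ u)
    (fun u _ => by
      refine le_trans ?_ (hμ u)
      rw [hηsq]
      calc 6 * Real.log (2 * D) / (7 * Real.log D / ℓ) ≤
            7 * Real.log D / (7 * Real.log D / ℓ) := by gcongr
        _ = ℓ := by field_simp
        _ ≤ ℓ / (1 - η) := le_div_self hℓ0.le (by linarith) (by linarith))
    (fun u _ v _ _ => by linarith)
    (fun u hu x hx T hT hT' => by
      have hle : (#(fibre π u) : ℝ) ≤ D := by
        have := (mem_filter.1 hu).2
        exact_mod_cast this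
      refine le_trans ?_ (hc.le_sum_indSets hlam hT (fun t => ℓ / 8 ≤ t) (8 * (D : ℝ) ^ 4) hT'.le
        (hZ (π x)))
      have : (0 : ℝ) ≤ (D : ℝ) ^ 3 := by positivity
      nlinarith)
  exact hc.exists_full D G.degree_le_maxDegree I hI fun u hu => hcov u (by simpa using hu)

/-- Local parameters. -/
theorem IsCover.exists_full_of_local (hc : IsCover G H π) (lam : ℝ) (hlam : 0 < lam)
    (b c : V → ℝ) (hb : ∀ u, 1 ≤ b u) (hc0 : ∀ u, 0 < c u)
    (hocc : ∀ x, ∀ T ⊆ crossNbrs H π x,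
      ∑ S ∈ indSets H T, (1 - c (π x) * S.card) * lam ^ S.card ≤ b (π x))
    (ℓ η : V → ℝ) (hℓ : ∀ u, 0 < ℓ u) (hη : ∀ u, 0 < η u) (hη1 : ∀ u, η u < 1)
    (hL : ∀ u, max (ℓ u / (1 - η u)) (6 * Real.log (2 * G.maxDegree) / η u ^ 2) ≤
      (#(fibre π u) - c u * G.degree u) / b u)
    (hZ : ∀ u : V, ∀ F : G.Subgraph, F.verts ⊆ G.neighborSet u → F.IsInduced →
        ellStar G ℓ u < F.verts.ncard →
        8 * (#(fibre π u) : ℝ) * (G.maxDegree : ℝ) ^ 3 ≤ (Z F).eval lam) :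
    ∃ J : Finset W, H.IsIndepSet (J : Set W) ∧ #J = Fintype.card V := by
  -- For maximum degree 0, `Real.log 0 = 0` makes the second entry of the maximum vanish; the first
  -- is positive, so all lists are nonempty.
  rcases Nat.eq_zero_or_pos G.maxDegree with h0 | h0
  · refine hc.exists_full 0 (fun u => h0 ▸ G.degree_le_maxDegree u) ∅
      (by simp [SimpleGraph.IsIndepSet]) fun u hu => ?_
    exfalso
    have h1 := (le_max_left _ _).trans (hL u)
    have h2 : 0 < ℓ u / (1 - η u) := div_pos (hℓ u) (by linarith [hη1 u])
    have h3 : ((#(fibre π u) : ℝ) - c u * G.degree u) / b u ≤ 0 := by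
      refine div_nonpos_of_nonpos_of_nonneg ?_ (by linarith [hb u])
      rw [Nat.le_zero.1 hu]
      have := hc0 u
      have : 0 ≤ c u * G.degree u := by positivity
      simp only [CharP.cast_eq_zero]
      linarith
    linarith
  · obtain ⟨I, hI, hcov⟩ := hc.exists_indepSet_of_occupancy lam hlam univ G.maxDegree h0
      G.degree_le_maxDegree ℓ η b c (ellStar G ℓ) (fun u _ => hℓ u) (fun u _ => hη u)
      (fun u _ => hη1 u) (fun u _ => hb u) (fun u _ => hc0 u)
      (fun u _ x hx T hT => mem_fibre.1 hx ▸ hocc x T hT)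
      (fun u _ => (le_max_left _ _).trans (hL u)) (fun u _ => (le_max_right _ _).trans (hL u))
      (fun u _ v _ h => by linarith [ellStar_le ℓ h])
      (fun u _ x hx T hT hT' => by
        rw [mem_fibre] at hx
        subst hx
        exact hc.le_sum_indSets hlam hT (fun t => ellStar G ℓ (π x) < t) _ hT' (hZ (π x)))
    exact hc.exists_full G.maxDegree G.degree_le_maxDegree I hI fun u _ => hcov u (mem_univ u)

omit [Fintype V] [Fintype W] [DecidableRel G.Adj] in
/-- The projection of a cover to the underlying graph. -/
theorem Cover.exists_projection (C : Cover G W) :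
    ∃ π : W → V, (∀ u x, x ∈ C.L u ↔ π x = u) ∧ IsCover G C.H π := by
  choose π hπ huniq using C.partition
  have hmem : ∀ u x, x ∈ C.L u ↔ π x = u :=
    fun u x => ⟨fun h => (huniq x u h).symm, fun h => h ▸ hπ x⟩
  refine ⟨π, hmem, ⟨?_, ?_, ?_⟩⟩
  · intro x y h hne
    exact C.complete (π y) x ((hmem _ _).2 h) y (hπ y) hne
  · intro x y h
    exact C.edge _ _ x (hπ x) y (hπ y) h
  · intro x y z hne h hxy hxz
    have hadj := (C.edge _ _ x (hπ x) y (hπ y) hxy).resolve_left hne.symm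
    exact C.matching _ _ hadj x (hπ x) y (hπ y) z ((hmem _ _).2 h.symm) hxy hxz

-- All cross neighbours of `x` carry the colour of `x`, so those over adjacent vertices are adjacent
-- in the cover.
omit [Fintype V] [DecidableRel G.Adj] in
theorem IsCover.imageSubgraph_isInduced {C : Cover G W} (hC : C.ArisesFromList)
    (hc : IsCover G C.H π) (hmem : ∀ u x, x ∈ C.L u ↔ π x = u) {x : W} {T : Finset W}
    (hT : T ⊆ crossNbrs C.H π x) : (imageSubgraph hc T).IsInduced := by
  obtain ⟨A, e, he⟩ := hC
  have hπ : ∀ y, (e y).1.1 = π y := fun y => (he _ y).1 ((hmem _ y).2 rfl)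
  have hcol : ∀ y ∈ T, (e x).1.2 = (e y).1.2 := by
    intro y hy
    have hy := mem_crossNbrs.1 (hT hy)
    have hadj : (listGraph G A).Adj (e x) (e y) := e.map_rel_iff.2 hy.1
    rcases hadj.2 with h | h
    · rw [hπ, hπ] at h
      exact absurd h.symm hy.2
    · exact h.2
  rintro _ ⟨y, hy, rfl⟩ _ ⟨z, hz, rfl⟩ hadj
  refine ⟨hadj.ne, y, hy, z, hz, rfl, rfl, e.map_rel_iff.1 ⟨fun h => hadj.ne ?_, Or.inr ⟨?_, ?_⟩⟩⟩
  · rw [← hπ y, h, hπ z]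
  · rwa [hπ, hπ]
  · rw [← hcol y hy, hcol z hz]

end

end Core

end LocalOccupancy

theorem theorem3p3 {V : Type*} {W : Type*} [Fintype V]
    (G : SimpleGraph V) [DecidableRel G.Adj] (C : LocalOccupancy.Cover G W)
    (lam : ℝ) (hlam : 0 < lam) (β γ : V → ℝ) (hβ : ∀ u, 0 < β u) (hγ : ∀ u, 0 < γ u) :
    -- the main theorem, with a uniform choice of parameters
    (∀ ℓ : ℝ, 2 ^ 6 ≤ G.maxDegree → 7 * Real.log G.maxDegree < ℓ →
      (∀ u : V, β u * (lam / (1 + lam)) * (ℓ / (1 - Real.sqrt (7 * Real.log G.maxDegree / ℓ)))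
          + γ u * G.degree u ≤ (C.L u).card) →
      (∀ u : V, ∀ F : G.Subgraph, F.verts ⊆ G.neighborSet u → F.IsInduced →
        ℓ / 8 ≤ F.verts.ncard →
        8 * (G.maxDegree : ℝ) ^ 4 ≤ (LocalOccupancy.Z F).eval lam) →
      (C.ArisesFromList → LocalOccupancy.HasLocalOccupancy G lam β γ → C.Colourable) ∧
      (LocalOccupancy.HasStrongLocalOccupancy G lam β γ → C.Colourable)) ∧
    -- its general form, with local parameters
    (∀ ℓ η : V → ℝ, (∀ u, 0 < ℓ u) → (∀ u, 0 < η u) → (∀ u, η u < 1) →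
      (∀ u : V, max (ℓ u / (1 - η u)) (6 * Real.log (2 * G.maxDegree) / η u ^ 2) ≤
        (1 + lam) / (β u * lam) * ((C.L u).card - γ u * G.degree u)) →
      (∀ u : V, ∀ F : G.Subgraph, F.verts ⊆ G.neighborSet u → F.IsInduced →
        LocalOccupancy.ellStar G ℓ u < F.verts.ncard →
        8 * ((C.L u).card : ℝ) * (G.maxDegree : ℝ) ^ 3 ≤ (LocalOccupancy.Z F).eval lam) →
      (C.ArisesFromList → LocalOccupancy.HasLocalOccupancy G lam β γ → C.Colourable) ∧
      (LocalOccupancy.HasStrongLocalOccupancy G lam β γ → C.Colourable)) := by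
  classical
  obtain ⟨π, hmem, hc⟩ := C.exists_projection
  have : Finite W := by
    refine Set.finite_univ_iff.1 ((Set.finite_iUnion fun u => (C.L u).finite_toSet).subset ?_)
    exact fun x _ => Set.mem_iUnion.2 ⟨π x, (hmem _ _).2 rfl⟩
  have := Fintype.ofFinite W
  have hL : ∀ u, C.L u = LocalOccupancy.fibre π u := fun u => by
    ext x
    rw [hmem, LocalOccupancy.mem_fibre]
  have hocc : ((∀ x, ∀ T ⊆ LocalOccupancy.crossNbrs C.H π x, LocalOccupancy.OccupancyBound lam
      (β (π x)) (γ (π x)) (LocalOccupancy.imageSubgraph hc T)) → ∀ x,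
      ∀ T ⊆ LocalOccupancy.crossNbrs C.H π x, ∑ S ∈ LocalOccupancy.indSets C.H T,
        (1 - γ (π x) * S.card) * lam ^ S.card ≤ β (π x) * (lam / (1 + lam))) := by
    intro h x T hT
    rw [← hc.sum_indepSets_imageSubgraph hT (fun n => (1 - γ (π x) * n) * lam ^ n)]
    exact LocalOccupancy.sum_le_of_occupancyBound hlam (h x T hT)
  have hlist : C.ArisesFromList → LocalOccupancy.HasLocalOccupancy G lam β γ →
      (∀ u, 1 ≤ β u * (lam / (1 + lam))) ∧ ∀ x, ∀ T ⊆ LocalOccupancy.crossNbrs C.H π x,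
      ∑ S ∈ LocalOccupancy.indSets C.H T,
        (1 - γ (π x) * S.card) * lam ^ S.card ≤ β (π x) * (lam / (1 + lam)) :=
    fun hC h => ⟨fun u => LocalOccupancy.one_le_of_occupancyBound_bot hlam
      (h u ⊥ (Set.empty_subset _) fun _ hv => absurd hv (Set.notMem_empty _)),
      hocc fun x T hT => h _ _ (hc.imageSubgraph_verts_subset hT)
        (LocalOccupancy.IsCover.imageSubgraph_isInduced hC hc hmem hT)⟩
  have hstrong : LocalOccupancy.HasStrongLocalOccupancy G lam β γ →
      (∀ u, 1 ≤ β u * (lam / (1 + lam))) ∧ ∀ x, ∀ T ⊆ LocalOccupancy.crossNbrs C.H π x,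
      ∑ S ∈ LocalOccupancy.indSets C.H T,
        (1 - γ (π x) * S.card) * lam ^ S.card ≤ β (π x) * (lam / (1 + lam)) :=
    fun h => ⟨fun u => LocalOccupancy.one_le_of_occupancyBound_bot hlam
      (h u ⊥ (Set.empty_subset _)),
      hocc fun x T hT => h _ _ (hc.imageSubgraph_verts_subset hT)⟩
  simp only [hL]
  refine ⟨fun ℓ hΔ hℓ hsize hZ => ?_, fun ℓ η hℓ hη hη1 hsize hZ => ?_⟩
  · have main := hc.exists_full_of_uniform lam hlam (fun u => β u * (lam / (1 + lam))) γ
    exact ⟨fun hC h => main (hlist hC h).1 hγ (hlist hC h).2 ℓ hΔ hℓ hsize hZ,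
      fun h => main (hstrong h).1 hγ (hstrong h).2 ℓ hΔ hℓ hsize hZ⟩
  · have main := hc.exists_full_of_local lam hlam (fun u => β u * (lam / (1 + lam))) γ
    have hsize' : ∀ u : V, max (ℓ u / (1 - η u)) (6 * Real.log (2 * G.maxDegree) / η u ^ 2) ≤
        ((LocalOccupancy.fibre π u).card - γ u * G.degree u) / (β u * (lam / (1 + lam))) := by
      intro u
      refine (hsize u).trans (le_of_eq ?_)
      have := hβ u
      field_simp
    exact ⟨fun hC h => main (hlist hC h).1 hγ (hlist hC h).2 ℓ η hℓ hη hη1 hsize' hZ,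
      fun h => main (hstrong h).1 hγ (hstrong h).2 ℓ η hℓ hη hη1 hsize' hZ⟩
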